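/- **Theorem 5.1.** Let $d\in\{2,3\}$ and $\Omega=[0,2\pi]^d$ with periodic boundary conditions. All functions are complex-valued and square integrable on $\Omega$ with zero space average; $\hat f(k)=(2\pi)^{-d}\int_\Omega f(x)e^{-ik\cdot x}\,dx$ for $k\in\mathbb Z^d$, and $A=-\Delta$. Let $H_{\mathbb C}$ be the space of divergence-free vector fields in $L^2(\Omega;\mathbb C^d)$ with zero space average, and $\mathbb P$ the Leray–Helmholtz projection, which acts on Fourier coefficients at $k\ne0$ by $w\mapsto w-\frac{k\cdot w}{|k|^2}k$. For $r,\beta>0$ put $$\|f\|_\beta^2=\|A^{r/2}e^{\beta A^{1/2}}f\|_{L^2}^2=(2\pi)^d\sum_{k\neq0}|k|^{2r}e^{2\beta|k|}|\hat f(k)|^2,\qquad \|(u,\eta)\|_\beta^2=\|u\|_\beta^2+\|\eta\|_\beta^2,$$ where $\|u\|_\beta^2=\sum_i\|u_i\|_\beta^2$, and $$C_W(r)=\frac1{\pi2^{d-1}}\,\frac{2r-d}{2r-1-d}.$$ There is a constant $C>0$ depending only on $d$ such that the following holds. Let $r>\frac{d+1}2$, $g>0$, $e\in\mathbb R^d$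 with $|e|=1$, $\beta_0>0$, and let $u_0\in H_{\mathbb C}$ and $\eta_0\in L^2(\Omega;\mathbb C)$ with zero space average (in particular, real-valued data are allowed) satisfy $\|(u_0,\eta_0)\|_{\beta_0}<\infty$. Let $$\mathcal R=\Big\{\zeta\in\mathbb C:\ 0<|\zeta|<\min\Big\{\frac{C\beta_0}{2^rC_W(r)\|(u_0,\eta_0)\|_{\beta_0}},\ \frac{2\ln2}{g}\Big\}\Big\},$$ where the first entry of the minimum is $+\infty$ if $(u_0,\eta_0)=0$. Then the complexified inviscid Boussinesq system (with the pressure eliminated by $\mathbb P$) $$\frac{du}{d\zeta}+\mathbb P\,\nabla\cdot(u\otimes u)=\mathbb P(g\,\eta\,e),\qquad \frac{d\eta}{d\zeta}+\nabla\cdot(u\,\eta)=0,\qquad \nabla\cdot u=0,\qquad (u,\eta)(0)=(u_0,\eta_0),$$ has exactly one solution $(u,\eta)$ on $\mathcal R$. Here products are complex bilinear, and a solution on $\mathcal R$ is a pair of holomorphic maps $u:\mathcal R\to H_{\mathbb C}$, $\eta:\mathcal R\to\{f\in L^2(\Omega;\mathbb C):\hat f(0)=0\}$ that satisfies the equations in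 the sense of distributions in $x$ (equality of all Fourier coefficients) for every $\zeta\in\mathcal R$, with $(u(\zeta),\eta(\zeta))\to(u_0,\eta_0)$ in $L^2$ as $\zeta\to0$, $\zeta\in\mathcal R$. Moreover this solution is holomorphic with values in Gevrey classes: for every $\zeta_0\in\mathcal R$ and each component $f$ of $(u,\eta)$ there is $\beta>0$ such that $\zeta\mapsto A^{r/2}e^{\beta A^{1/2}}f(\zeta)$ is defined near $\zeta_0$ and holomorphic there with values in $L^2$. -/

import Mathlib

open MeasureTheory Topology Filter
open scoped ENNReal

noncomputable section

namespace Boussinesq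

instance fact_two_pi_pos : Fact (0 < 2 * Real.pi) := ⟨Real.two_pi_pos⟩

/-- The spatial domain `[0, 2π]^d` with periodic boundary conditions, carrying Lebesgue measure
(of total mass `(2π)^d`). -/
abbrev Torus (d : ℕ) : Type := Fin d → AddCircle (2 * Real.pi)

/-- The complexified Hilbert space of (classes of) square integrable functions on the torus. -/
abbrev L2 (d : ℕ) : Type := Lp ℂ 2 (volume : Measure (Torus d))

/-- The frequency lattice `ℤ^d`. -/
abbrev Freq (d : ℕ) : Type := Fin d → ℤ

/-- The Euclidean length `|k|` of a frequency. -/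
def freqNorm {d : ℕ} (k : Freq d) : ℝ := Real.sqrt (∑ i, (k i : ℝ) ^ 2)

/-- The character `x ↦ exp(i k · x)`. -/
def character {d : ℕ} (k : Freq d) (x : Torus d) : ℂ := ∏ i, (fourier (k i) (x i) : ℂ)

/-- The Fourier coefficient `(2π)^{-d} ∫ f(x) exp(-i k · x) dx`. -/
def coeff {d : ℕ} (f : Torus d → ℂ) (k : Freq d) : ℂ :=
  (((2 * Real.pi) ^ d : ℝ) : ℂ)⁻¹ * ∫ x : Torus d, f x * character (-k) x

/-- Space average zero. -/
def MeanZero {d : ℕ} (f : L2 d) : Prop := coeff f 0 = 0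

/-- The complexified velocity space: square integrable vector fields with space
average zero and zero divergence (in the sense of distributions, i.e. `k · û(k) = 0`). -/
def InH {d : ℕ} (u : Fin d → L2 d) : Prop :=
  (∀ i, MeanZero (u i)) ∧ ∀ k : Freq d, ∑ i, (k i : ℂ) * coeff (u i) k = 0

/-- The Fourier symbol `|k|^r exp(β |k|)` of the operator `A^{r/2} exp(β A^{1/2})`, `A = -Δ`. -/
def gevreyWeight {d : ℕ} (r β : ℝ) (k : Freq d) : ℝ :=
  freqNorm k ^ r * Real.exp (β * freqNorm k)

/-- The squared Gevrey norm
`‖f‖_β² = ‖A^{r/2} exp(β A^{1/2}) f‖² = (2π)^d ∑_k |k|^{2r} exp(2β|k|) |f̂(k)|²` (possibly `∞`). -/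
def gevreySq {d : ℕ} (r β : ℝ) (f : L2 d) : ℝ≥0∞ :=
  ENNReal.ofReal ((2 * Real.pi) ^ d) *
    ∑' k : Freq d, ENNReal.ofReal ((gevreyWeight r β k * ‖coeff f k‖) ^ 2)

/-- The combined Gevrey norm: `‖(u, η)‖_β² = ‖u‖_β² + ‖η‖_β²`. -/
def gevreyNorm {d : ℕ} (r β : ℝ) (u : Fin d → L2 d) (η : L2 d) : ℝ≥0∞ :=
  ((∑ i, gevreySq r β (u i)) + gevreySq r β η) ^ (1 / 2 : ℝ)

/-- The constant `C_W(r) = (1 / (π 2^{d-1})) (2r - d) / (2r - 1 - d)`. -/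
def wienerConst (d : ℕ) (r : ℝ) : ℝ :=
  1 / (Real.pi * 2 ^ ((d : ℝ) - 1)) * ((2 * r - d) / (2 * r - 1 - d))

/-- The punctured disc `0 < |ζ| < min {C β₀ / (2^r C_W(r) N), 2 ln 2 / g}`.  The minimum is taken
in `[0, ∞]`, so the first entry is `∞` for `N = 0`. -/
def region (d : ℕ) (C r g β₀ : ℝ) (N : ℝ≥0∞) : Set ℂ :=
  {ζ | 0 < ‖ζ‖ ∧ ENNReal.ofReal ‖ζ‖ <
    min (ENNReal.ofReal (C * β₀) / (ENNReal.ofReal (2 ^ r * wienerConst d r) * N))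
      (ENNReal.ofReal (2 * Real.log 2 / g))}

/-- The Fourier coefficients of `∇ · (f u)`, which is `(u · ∇) f` for divergence free `u`.
For complex-valued `u`, `f` this is the complex bilinear extension of the real term. -/
def advectionCoeff {d : ℕ} (u : Fin d → L2 d) (f : L2 d) (k : Freq d) : ℂ :=
  ∑ j, Complex.I * (k j : ℂ) * coeff (fun x => u j x * f x) k

/-- The Leray-Helmholtz projection onto mean-free divergence free fields, acting on the Fourier
coefficient at frequency `k`: `w ↦ w - (k · w) k / |k|²`, and `0` for `k = 0`. -/
def leray {d : ℕ} (k : Freq d) (w : Fin d → ℂ) (i : Fin d) : ℂ :=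
  if k = 0 then 0
  else w i - (∑ j, (k j : ℂ) * w j) / ((freqNorm k ^ 2 : ℝ) : ℂ) * (k i : ℂ)

/-- `(u, η)` is a solution, on a region `R` of complex times, of the complexified inviscid
Boussinesq system
`du/dζ + P (u · ∇) u = P (g η e)`, `dη/dζ + (u · ∇) η = 0`, `∇ · u = 0`, `(u, η)(0) = (u₀, η₀)`:
`u` and `η` are holomorphic on `R` with values in the complexified phase spaces, the
equations hold in the sense of (periodic, mean-free) distributions in space, and the
initial data are attained in `L²` as `ζ → 0` in `R`. -/
structure IsSolution {d : ℕ} (g : ℝ) (e : EuclideanSpace ℝ (Fin d)) (u₀ : Fin d → L2 d)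
    (η₀ : L2 d) (R : Set ℂ) (u : ℂ → Fin d → L2 d) (η : ℂ → L2 d) : Prop where
  velocity_mem : ∀ ζ ∈ R, InH (u ζ)
  scalar_mem : ∀ ζ ∈ R, MeanZero (η ζ)
  velocity_holo : DifferentiableOn ℂ u R
  scalar_holo : DifferentiableOn ℂ η R
  momentum : ∀ ζ ∈ R, ∀ (k : Freq d) (i : Fin d),
    coeff (⇑(deriv u ζ i)) k + leray k (fun l => advectionCoeff (u ζ) (u ζ l) k) i =
      leray k (fun l => (g : ℂ) * coeff (η ζ) k * (e l : ℂ)) i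
  transport : ∀ ζ ∈ R, ∀ k : Freq d,
    coeff (⇑(deriv η ζ)) k + advectionCoeff (u ζ) (η ζ) k = 0
  velocity_init : Tendsto u (𝓝[R] 0) (𝓝 u₀)
  scalar_init : Tendsto η (𝓝[R] 0) (𝓝 η₀)

/-- Near the complex time `ζ₀`, `f` is holomorphic with values in a Gevrey class: for some `β > 0`,
the function `ζ ↦ A^{r/2} exp(β A^{1/2}) f(ζ)` is defined near `ζ₀`
and holomorphic with values in `L²`. -/
def GevreyHolomorphicAt {d : ℕ} (r : ℝ) (f : ℂ → L2 d) (ζ₀ : ℂ) : Prop :=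
  ∃ β : ℝ, 0 < β ∧ ∃ F : ℂ → L2 d, AnalyticAt ℂ F ζ₀ ∧
    ∀ᶠ ζ in 𝓝 ζ₀, ∀ k : Freq d, coeff (F ζ) k = (gevreyWeight r β k : ℂ) * coeff (f ζ) k

end Boussinesq

end

noncomputable section

namespace Boussinesq

variable {d : ℕ}

/-! ### Fourier analysis on the torus -/

/-! Existence is a Cauchy–Kovalevskaya argument in the scale of norms `wienerNorm β`. Each norm is
submultiplicative under convolution (`wienerNorm_conv_le`), the Leray projection is bounded, and a
space derivative costs `1 / ε` when `β` drops by `ε` (`wienerNorm_deriv_le`). The equations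
determine the Taylor coefficients in `ζ` recursively (`taylorCoeff`). At weight `β₀ - δ` the `n`-th
coefficient is bounded by a constant times `(n + 1)⁻² (c / δ) ^ n` (`taylorCoeff_bounds`): the loss
`ε = δ / (n + 2)` is paid for by the factor `1 / (n + 1)` from integration in time, and `(n + 1)⁻²`
is stable under discrete convolution. So the series converges for `|ζ| < β₀ / c` with a positive
weight left over, which gives a holomorphic Gevrey-valued solution.

With `ρ` the radius of the region, the choice `c = β₀ / ρ` is admissible for two reasons: `g ρ ≤ 2`
controls the buoyancy term, and a bound on `ρ N` by a small multiple of `β₀` controls the quadratic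
terms. Cauchy–Schwarz bounds the Wiener norm by the Gevrey norm with a constant depending only on
`d` (`wienerNorm_coeff_le`), since `2r > d + 1`. Of the factor `2 ^ r C_W(r)` only a lower bound
depending on `d` is needed.

Uniqueness requires no Gevrey regularity of the competitor. Fourier coefficients of products are
bounded bilinear forms on `L²`, and a solution extends analytically across `ζ = 0`. If two solutions
differed, their difference would be `ζ ^ n h(ζ)` with `h(0) ≠ 0` and `n ≥ 1`; dividing the equation
by `ζ ^ (n - 1)` and letting `ζ → 0` gives `n h(0) = 0` (`eventuallyEq_of_weak_quadratic_ode`). The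
identity theorem does the rest. -/

lemma continuous_character (k : Freq d) : Continuous (character k) := by
  unfold character
  fun_prop

/-- The character `x ↦ exp(i k · x)` as a continuous map. -/
def characterC (k : Freq d) : C(Torus d, ℂ) := ⟨character k, continuous_character k⟩

@[simp] lemma characterC_apply (k : Freq d) (x : Torus d) : characterC k x = character k x := rfl

lemma character_add (k l : Freq d) (x : Torus d) :
    character (k + l) x = character k x * character l x := by
  simp only [character, Pi.add_apply, fourier_add, ← Finset.prod_mul_distrib]

@[simp] lemma character_zero (x : Torus d) : character (0 : Freq d) x = 1 := by
  simp [character]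

lemma character_neg (k : Freq d) (x : Torus d) :
    character (-k) x = starRingEnd ℂ (character k x) := by
  simp only [character, Pi.neg_apply, fourier_neg, map_prod]

lemma norm_character (k : Freq d) (x : Torus d) : ‖character k x‖ = 1 := by
  simp only [character, norm_prod, fourier_apply, Circle.norm_coe, Finset.prod_const_one]

lemma integral_fourier_eq_ite (n : ℤ) :
    ∫ x : AddCircle (2 * Real.pi), (fourier n x : ℂ) =
      if n = 0 then ((2 * Real.pi : ℝ) : ℂ) else 0 := by
  split_ifs with h
  · subst h
    have : (volume : Measure (AddCircle (2 * Real.pi))).real Set.univ = 2 * Real.pi := by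
      simp [Measure.real, AddCircle.measure_univ, Real.pi_pos.le]
    simp [this]
  · exact integral_eq_zero_of_add_right_eq_neg (μ := volume)
      (fourier_add_half_inv_index h (Fact.out : 0 < 2 * Real.pi))

lemma integral_character (k : Freq d) :
    ∫ x : Torus d, character k x = if k = 0 then (((2 * Real.pi) ^ d : ℝ) : ℂ) else 0 := by
  unfold character
  rw [integral_fintype_prod_volume_eq_prod (f := fun i x => (fourier (k i) x : ℂ))]
  simp only [integral_fourier_eq_ite]
  split_ifs with h
  · simp [h]
  · obtain ⟨i, hi⟩ := Function.ne_iff.mp h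
    exact Finset.prod_eq_zero (Finset.mem_univ i) (if_neg hi)

/-- The character `x ↦ exp(i k · x)` as an element of `L²`. -/
def charLp (k : Freq d) : L2 d := ContinuousMap.toLp 2 volume ℂ (characterC k)

lemma coeFn_charLp (k : Freq d) : charLp k =ᵐ[volume] character k :=
  ContinuousMap.coeFn_toLp volume (characterC k)

lemma two_pi_pow_ne_zero (d : ℕ) : (((2 * Real.pi) ^ d : ℝ) : ℂ) ≠ 0 := by
  have := Real.pi_pos
  exact_mod_cast (by positivity : (2 * Real.pi) ^ d ≠ 0)

/-- The `k`-th Fourier coefficient as a continuous linear functional on `L²`. -/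
def coeffL (k : Freq d) : L2 d →L[ℂ] ℂ :=
  (((2 * Real.pi) ^ d : ℝ) : ℂ)⁻¹ •
    (ContinuousLinearMap.lpPairing volume 2 2 (ContinuousLinearMap.mul ℂ ℂ)).flip (charLp (-k))

lemma coeffL_apply (k : Freq d) (f : L2 d) : coeffL k f = coeff f k := by
  simp only [coeffL, _root_.smul_apply, ContinuousLinearMap.flip_apply,
    ContinuousLinearMap.lpPairing_eq_integral, coeff, smul_eq_mul]
  congr 1
  apply integral_congr_ae
  filter_upwards [coeFn_charLp (-k)] with x hx
  simp [hx]

/-- The bilinear form sending `(f, g)` to the `k`-th Fourier coefficient of the product `f g`. -/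
def prodCoeffL (k : Freq d) : L2 d →L[ℂ] L2 d →L[ℂ] ℂ :=
  ((((((2 * Real.pi) ^ d : ℝ) : ℂ)⁻¹ •
    (ContinuousLinearMap.lpPairing volume 1 ∞ (ContinuousLinearMap.mul ℂ ℂ)).flip
      (ContinuousMap.toLp ∞ volume ℂ (characterC (-k)))) :
        Lp ℂ 1 (volume : Measure (Torus d)) →L[ℂ] ℂ).postcomp (L2 d)) ∘L
    ((ContinuousLinearMap.mul ℂ ℂ).holderL volume 2 2 1)

lemma prodCoeffL_apply (k : Freq d) (f g : L2 d) :
    prodCoeffL k f g = coeff (fun x => f x * g x) k := by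
  simp only [prodCoeffL, ContinuousLinearMap.comp_apply, ContinuousLinearMap.postcomp_apply,
    _root_.smul_apply, ContinuousLinearMap.flip_apply,
    ContinuousLinearMap.lpPairing_eq_integral, coeff, smul_eq_mul]
  congr 1
  apply integral_congr_ae
  filter_upwards [ContinuousMap.coeFn_toLp (p := ∞) (𝕜 := ℂ) volume (characterC (-k)),
    (ContinuousLinearMap.mul ℂ ℂ).coeFn_holder (r := 1) f g] with x hx hy
  simp only [ContinuousLinearMap.holderL_apply_apply, ContinuousLinearMap.mul_apply'] at hy ⊢
  rw [hx, hy]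
  simp

lemma coeffL_charLp (k p : Freq d) : coeffL k (charLp p) = if p = k then 1 else 0 := by
  have h : ∫ x : Torus d, charLp p x * character (-k) x = ∫ x : Torus d, character (p - k) x := by
    apply integral_congr_ae
    filter_upwards [coeFn_charLp p] with x hx
    simp only [hx, sub_eq_add_neg, character_add]
  rw [coeffL_apply, coeff, h, integral_character]
  simp only [sub_eq_zero]
  split_ifs
  · exact inv_mul_cancel₀ (two_pi_pow_ne_zero d)
  · simp

lemma prodCoeffL_charLp (k p q : Freq d) :
    prodCoeffL k (charLp p) (charLp q) = if p + q = k then 1 else 0 := by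
  have h : ∫ x : Torus d, charLp p x * charLp q x * character (-k) x =
      ∫ x : Torus d, character (p + q - k) x := by
    apply integral_congr_ae
    filter_upwards [coeFn_charLp p, coeFn_charLp q] with x hx hy
    simp only [hx, hy, sub_eq_add_neg, character_add]
  rw [prodCoeffL_apply, coeff, h, integral_character]
  simp only [sub_eq_zero]
  split_ifs
  · exact inv_mul_cancel₀ (two_pi_pow_ne_zero d)
  · simp

lemma exists_norm_charLp_le (d : ℕ) : ∃ M : ℝ, 0 ≤ M ∧ ∀ k : Freq d, ‖charLp k‖ ≤ M := by
  refine ⟨‖(ContinuousMap.toLp 2 volume ℂ : C(Torus d, ℂ) →L[ℂ] L2 d)‖, norm_nonneg _,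
    fun k => ?_⟩
  refine (ContinuousLinearMap.le_opNorm _ _).trans (mul_le_of_le_one_right (norm_nonneg _) ?_)
  exact (ContinuousMap.norm_le _ zero_le_one).2 fun x => (norm_character k x).le

/-- The star subalgebra of `C(Torus d, ℂ)` generated by the characters. -/
def characterSubalgebra (d : ℕ) : StarSubalgebra ℂ C(Torus d, ℂ) where
  toSubalgebra := Algebra.adjoin ℂ (Set.range characterC)
  star_mem' := by
    change Algebra.adjoin ℂ (Set.range characterC) ≤
      star (Algebra.adjoin ℂ (Set.range characterC))
    refine Algebra.adjoin_le ?_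
    rintro _ ⟨n, rfl⟩
    refine Algebra.subset_adjoin ⟨-n, ?_⟩
    ext1 x
    simp only [characterC_apply, character_neg, starRingEnd_apply, ContinuousMap.star_apply]

/-- Characters are closed under multiplication and contain `1`, so generating an algebra adds
nothing to their linear span. -/
lemma characterSubalgebra_coe :
    Subalgebra.toSubmodule (characterSubalgebra d).toSubalgebra =
      Submodule.span ℂ (Set.range characterC) := by
  apply Algebra.adjoin_eq_span_of_subset
  refine .trans (fun x => Submonoid.closure_induction (fun _ => id) ⟨0, ?_⟩ ?_)
    Submodule.subset_span
  · ext z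
    simp
  · rintro _ _ _ _ ⟨m, rfl⟩ ⟨n, rfl⟩
    exact ⟨m + n, by ext z; simp [character_add]⟩

lemma character_single (z : Torus d) (i : Fin d) :
    character (Pi.single i 1) z = fourier 1 (z i) := by
  rw [character, Finset.prod_eq_single i]
  · simp
  · intro j _ hj
    simp [Pi.single_eq_of_ne hj]
  · simp

/-- Points differing in coordinate `i` are separated by `exp(i xᵢ)`, which is injective on one
period. -/
lemma characterSubalgebra_separatesPoints : (characterSubalgebra d).SeparatesPoints := by
  intro x y hxy
  obtain ⟨i, hi⟩ := Function.ne_iff.mp hxy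
  refine ⟨_, ⟨characterC (Pi.single i 1), Algebra.subset_adjoin ⟨Pi.single i 1, rfl⟩, rfl⟩, ?_⟩
  dsimp only
  rw [characterC_apply, characterC_apply, character_single, character_single, fourier_one,
    fourier_one, Ne, Circle.coe_inj]
  contrapose hi
  exact AddCircle.injective_toCircle Real.two_pi_pos.ne' hi

/-- Stone–Weierstrass gives uniform density, which passes to `L²` because continuous functions are
dense there. -/
lemma span_charLp_closure_eq_top :
    (Submodule.span ℂ (Set.range (charLp (d := d)))).topologicalClosure = ⊤ := by
  have h : (Submodule.span ℂ (Set.range (characterC (d := d)))).topologicalClosure = ⊤ := by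
    rw [← characterSubalgebra_coe]
    exact congr_arg (Subalgebra.toSubmodule <| StarSubalgebra.toSubalgebra ·)
      (ContinuousMap.starSubalgebra_topologicalClosure_eq_top_of_separatesPoints _
        characterSubalgebra_separatesPoints)
  have h' := (ContinuousMap.toLp_denseRange ℂ (volume : Measure (Torus d)) ℂ
    (p := 2) (by simp)).topologicalClosure_map_submodule h
  rw [Submodule.map_span, ← Set.range_comp] at h'
  exact h'

/-- Such an `f` is orthogonal to the dense span of the characters. -/
lemma eq_zero_of_coeffL_eq_zero (f : L2 d) (h : ∀ k, coeffL k f = 0) : f = 0 := by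
  have hpair : ∀ k, inner ℂ (charLp k) f = 0 := by
    intro k
    rw [MeasureTheory.L2.inner_def]
    have h2 := h k
    rw [coeffL_apply, coeff, mul_eq_zero, or_iff_right (inv_ne_zero (two_pi_pow_ne_zero d))] at h2
    rw [← h2]
    apply integral_congr_ae
    filter_upwards [coeFn_charLp k] with x hx
    simp [hx, character_neg]
  have hmem : f ∈ (Submodule.span ℂ (Set.range (charLp (d := d))))ᗮ := by
    rw [Submodule.mem_orthogonal]
    intro u hu
    induction hu using Submodule.span_induction with
    | mem x hx => obtain ⟨k, rfl⟩ := hx; exact hpair k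
    | zero => simp
    | add x y _ _ hx hy => rw [inner_add_left, hx, hy, add_zero]
    | smul c x _ hx => rw [inner_smul_left, hx, mul_zero]
  rw [(Submodule.topologicalClosure_eq_top_iff).1 span_charLp_closure_eq_top] at hmem
  exact (Submodule.mem_bot ℂ).1 hmem

lemma eq_of_coeff_eq {f g : L2 d} (h : ∀ k, coeff f k = coeff g k) : f = g := by
  rw [← sub_eq_zero]
  refine eq_zero_of_coeffL_eq_zero _ fun k => ?_
  rw [map_sub, coeffL_apply, coeffL_apply, h, sub_self]

/-- The `L²` function with absolutely summable Fourier coefficients `a`. -/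
def ofCoeff (a : Freq d → ℂ) : L2 d := ∑' k, a k • charLp k

/-- The convolution of two sequences indexed by frequencies. -/
def conv (a b : Freq d → ℂ) (k : Freq d) : ℂ := ∑' p, a p * b (k - p)

lemma summable_norm_smul_charLp {a : Freq d → ℂ} (ha : Summable fun k => ‖a k‖) :
    Summable fun k => ‖a k • charLp k‖ := by
  obtain ⟨M, -, hM⟩ := exists_norm_charLp_le d
  refine Summable.of_nonneg_of_le (fun _ => norm_nonneg _) (fun k => ?_) (ha.mul_right M)
  rw [norm_smul]
  exact mul_le_mul_of_nonneg_left (hM k) (norm_nonneg _)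

lemma hasSum_ofCoeff {a : Freq d → ℂ} (ha : Summable fun k => ‖a k‖) :
    HasSum (fun k => a k • charLp k) (ofCoeff a) :=
  (summable_norm_smul_charLp ha).of_norm.hasSum

lemma coeff_ofCoeff {a : Freq d → ℂ} (ha : Summable fun k => ‖a k‖) (k : Freq d) :
    coeff (ofCoeff a) k = a k := by
  rw [← coeffL_apply]
  refine ((coeffL k).hasSum (hasSum_ofCoeff ha)).unique ?_
  simp only [map_smul, coeffL_charLp, smul_eq_mul]
  convert hasSum_ite_eq k (a k) using 2 with p
  split_ifs with h <;> simp [h]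

/-- Continuity in each argument allows expanding both series; against the character `p`, only
frequency `k - p` of the second factor survives. -/
lemma prodCoeffL_ofCoeff {a b : Freq d → ℂ} (ha : Summable fun k => ‖a k‖)
    (hb : Summable fun k => ‖b k‖) (k : Freq d) :
    prodCoeffL k (ofCoeff a) (ofCoeff b) = conv a b k := by
  have h1 := ((prodCoeffL k).flip (ofCoeff b)).hasSum (hasSum_ofCoeff ha)
  rw [ContinuousLinearMap.flip_apply] at h1
  rw [← h1.tsum_eq, conv]
  refine tsum_congr fun p => ?_
  rw [map_smul, ContinuousLinearMap.flip_apply, smul_eq_mul]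
  congr 1
  refine ((prodCoeffL k (charLp p)).hasSum (hasSum_ofCoeff hb)).unique ?_
  convert hasSum_ite_eq (k - p) (b (k - p)) using 2 with q
  simp only [map_smul, prodCoeffL_charLp, smul_eq_mul, eq_sub_iff_add_eq']
  split_ifs with h
  · simp [← h]
  · simp

lemma exists_norm_ofCoeff_le (d : ℕ) : ∃ M : ℝ, 0 ≤ M ∧ ∀ a : Freq d → ℂ,
    (Summable fun k => ‖a k‖) → ‖ofCoeff a‖ ≤ M * ∑' k, ‖a k‖ := by
  obtain ⟨M, hM0, hM⟩ := exists_norm_charLp_le d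
  refine ⟨M, hM0, fun a ha => ?_⟩
  rw [← tsum_mul_left]
  refine tsum_of_norm_bounded (ha.mul_left M).hasSum fun k => ?_
  rw [norm_smul, mul_comm]
  exact mul_le_mul_of_nonneg_right (hM k) (norm_nonneg _)

/-! ### Exponentially weighted Wiener norms -/

lemma freqNorm_nonneg (k : Freq d) : 0 ≤ freqNorm k := Real.sqrt_nonneg _

lemma freqNorm_eq_norm (k : Freq d) :
    freqNorm k = ‖(WithLp.toLp 2 (fun i => (k i : ℝ)) : EuclideanSpace ℝ (Fin d))‖ := by
  simp [freqNorm, EuclideanSpace.norm_eq]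

lemma freqNorm_add_le (k l : Freq d) : freqNorm (k + l) ≤ freqNorm k + freqNorm l := by
  simp only [freqNorm_eq_norm]
  refine le_trans (le_of_eq ?_) (norm_add_le _ _)
  congr 1
  ext i
  simp

lemma abs_le_freqNorm (k : Freq d) (i : Fin d) : |(k i : ℝ)| ≤ freqNorm k :=
  Real.abs_le_sqrt (Finset.single_le_sum (f := fun i => (k i : ℝ) ^ 2)
    (fun _ _ => sq_nonneg _) (Finset.mem_univ i))

@[simp] lemma freqNorm_zero : freqNorm (0 : Freq d) = 0 := by simp [freqNorm]

lemma one_le_freqNorm {k : Freq d} (hk : k ≠ 0) : 1 ≤ freqNorm k := by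
  obtain ⟨i, hi⟩ := Function.ne_iff.mp hk
  refine le_trans ?_ (abs_le_freqNorm k i)
  exact_mod_cast Int.one_le_abs hi

/-- The norm `∑ k, exp(β |k|) |a k|` of the exponentially weighted Wiener algebra. -/
def wienerNorm (β : ℝ) (a : Freq d → ℂ) : ℝ≥0∞ :=
  ∑' k, ENNReal.ofReal (Real.exp (β * freqNorm k)) * ‖a k‖ₑ

lemma wienerNorm_mono {β β' : ℝ} (h : β ≤ β') (a : Freq d → ℂ) :
    wienerNorm β a ≤ wienerNorm β' a := by
  unfold wienerNorm
  gcongr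
  exact freqNorm_nonneg _

lemma wienerNorm_add_le (β : ℝ) (a b : Freq d → ℂ) :
    wienerNorm β (fun k => a k + b k) ≤ wienerNorm β a + wienerNorm β b := by
  unfold wienerNorm
  rw [← ENNReal.tsum_add]
  refine ENNReal.tsum_le_tsum fun k => ?_
  rw [← mul_add]
  gcongr
  exact enorm_add_le _ _

lemma wienerNorm_sum_le {ι : Type*} (s : Finset ι) (β : ℝ) (a : ι → Freq d → ℂ) :
    wienerNorm β (fun k => ∑ i ∈ s, a i k) ≤ ∑ i ∈ s, wienerNorm β (a i) := by
  unfold wienerNorm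
  rw [← Summable.tsum_finsetSum fun _ _ => ENNReal.summable]
  refine ENNReal.tsum_le_tsum fun k => ?_
  rw [← Finset.mul_sum]
  gcongr
  exact enorm_sum_le _ _

lemma wienerNorm_mul_left (β : ℝ) (c : ℂ) (a : Freq d → ℂ) :
    wienerNorm β (fun k => c * a k) = ‖c‖ₑ * wienerNorm β a := by
  unfold wienerNorm
  rw [← ENNReal.tsum_mul_left]
  refine tsum_congr fun k => ?_
  rw [enorm_mul]
  ring

lemma wienerNorm_neg (β : ℝ) (a : Freq d → ℂ) :
    wienerNorm β (fun k => -a k) = wienerNorm β a := by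
  simp [wienerNorm]

lemma tsum_enorm_le_wienerNorm {β : ℝ} (hβ : 0 ≤ β) (a : Freq d → ℂ) :
    ∑' k, ‖a k‖ₑ ≤ wienerNorm β a := by
  refine ENNReal.tsum_le_tsum fun k => le_mul_of_one_le_left (zero_le) ?_
  rw [ENNReal.one_le_ofReal]
  exact Real.one_le_exp (mul_nonneg hβ (freqNorm_nonneg k))

lemma summable_norm_of_wienerNorm_ne_top {β : ℝ} (hβ : 0 ≤ β) {a : Freq d → ℂ}
    (h : wienerNorm β a ≠ ∞) : Summable fun k => ‖a k‖ := by
  have h1 : ∑' k, ‖a k‖ₑ ≠ ∞ := ne_top_of_le_ne_top h (tsum_enorm_le_wienerNorm hβ a)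
  simpa using ENNReal.summable_toReal h1

lemma tsum_norm_le_toReal_wienerNorm {β : ℝ} (hβ : 0 ≤ β) {a : Freq d → ℂ}
    (h : wienerNorm β a ≠ ∞) : ∑' k, ‖a k‖ ≤ (wienerNorm β a).toReal := by
  have h1 : ∑' k, ‖a k‖ₑ ≠ ∞ := ne_top_of_le_ne_top h (tsum_enorm_le_wienerNorm hβ a)
  refine le_trans (le_of_eq ?_) (ENNReal.toReal_mono h (tsum_enorm_le_wienerNorm hβ a))
  rw [ENNReal.tsum_toReal_eq fun _ => enorm_ne_top]
  simp

/-- The weighted Wiener algebra is submultiplicative under convolution. -/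
lemma wienerNorm_conv_le {β : ℝ} (hβ : 0 ≤ β) (a b : Freq d → ℂ) :
    wienerNorm β (conv a b) ≤ wienerNorm β a * wienerNorm β b := by
  set w : Freq d → ℝ≥0∞ := fun k => ENNReal.ofReal (Real.exp (β * freqNorm k)) with hw
  -- The triangle inequality `|k| ≤ |p| + |k - p|` makes the weight submultiplicative.
  have hwle : ∀ k p : Freq d, w k ≤ w p * w (k - p) := by
    intro k p
    rw [hw, ← ENNReal.ofReal_mul (Real.exp_nonneg _), ← Real.exp_add, ← mul_add]
    refine ENNReal.ofReal_le_ofReal (Real.exp_le_exp.2 (mul_le_mul_of_nonneg_left ?_ hβ))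
    simpa using freqNorm_add_le p (k - p)
  calc wienerNorm β (conv a b)
      ≤ ∑' k, ∑' p, (w p * ‖a p‖ₑ) * (w (k - p) * ‖b (k - p)‖ₑ) := by
        refine ENNReal.tsum_le_tsum fun k => ?_
        refine (mul_le_mul_right (enorm_tsum_le_tsum_enorm (f := fun p => a p * b (k - p))) _).trans ?_
        rw [← ENNReal.tsum_mul_left]
        refine ENNReal.tsum_le_tsum fun p => ?_
        rw [enorm_mul]
        calc w k * (‖a p‖ₑ * ‖b (k - p)‖ₑ)
            ≤ (w p * w (k - p)) * (‖a p‖ₑ * ‖b (k - p)‖ₑ) := by gcongr; exact hwle k p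
          _ = _ := by ring
    _ = ∑' p, ∑' k, (w p * ‖a p‖ₑ) * (w (k - p) * ‖b (k - p)‖ₑ) := ENNReal.tsum_comm
    _ = ∑' p, (w p * ‖a p‖ₑ) * wienerNorm β b := by
        refine tsum_congr fun p => ?_
        rw [ENNReal.tsum_mul_left]
        congr 1
        exact (Equiv.subRight p).tsum_eq fun q => w q * ‖b q‖ₑ
    _ = wienerNorm β a * wienerNorm β b := ENNReal.tsum_mul_right

lemma mul_exp_neg_le {x ε : ℝ} (hε : 0 < ε) : x * Real.exp (-(ε * x)) ≤ 1 / ε := by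
  rw [Real.exp_neg, le_div_iff₀ hε, mul_assoc, mul_comm _ ε, ← mul_assoc, ← div_eq_mul_inv,
    div_le_one (Real.exp_pos _)]
  linarith [Real.add_one_le_exp (ε * x)]

/-- A derivative costs a factor `1 / ε` when the exponential weight is lowered by `ε`. -/
lemma wienerNorm_deriv_le {β ε : ℝ} (hε : 0 < ε) (j : Fin d) (a : Freq d → ℂ) :
    wienerNorm (β - ε) (fun k => Complex.I * (k j : ℂ) * a k) ≤
      ENNReal.ofReal (1 / ε) * wienerNorm β a := by
  unfold wienerNorm
  rw [← ENNReal.tsum_mul_left]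
  refine ENNReal.tsum_le_tsum fun k => ?_
  have h1 : ‖Complex.I * (k j : ℂ) * a k‖ₑ ≤ ENNReal.ofReal (freqNorm k) * ‖a k‖ₑ := by
    rw [enorm_mul]
    gcongr
    rw [← ofReal_norm]
    refine ENNReal.ofReal_le_ofReal ?_
    simpa using abs_le_freqNorm k j
  refine (mul_le_mul_right h1 _).trans ?_
  rw [← mul_assoc, ← mul_assoc, ← ENNReal.ofReal_mul (Real.exp_nonneg _),
    ← ENNReal.ofReal_mul (by positivity)]
  refine mul_le_mul_left (ENNReal.ofReal_le_ofReal ?_) _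
  calc Real.exp ((β - ε) * freqNorm k) * freqNorm k
      = freqNorm k * Real.exp (-(ε * freqNorm k)) * Real.exp (β * freqNorm k) := by
        rw [mul_assoc, ← Real.exp_add, mul_comm]
        ring_nf
    _ ≤ _ := by gcongr; exact mul_exp_neg_le hε

/-- The sum of the weighted Wiener norms of the components. -/
def vecNorm (β : ℝ) (u : Fin d → Freq d → ℂ) : ℝ≥0∞ := ∑ i, wienerNorm β (u i)

/-- The Fourier coefficients of `∇ · (f u)` in terms of those of `u` and `f`. -/
def advConv (u : Fin d → Freq d → ℂ) (f : Freq d → ℂ) (k : Freq d) : ℂ :=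
  ∑ j, Complex.I * (k j : ℂ) * conv (u j) f k

lemma wienerNorm_advConv_le {β ε : ℝ} (hβ : 0 ≤ β) (hε : 0 < ε) (u : Fin d → Freq d → ℂ)
    (f : Freq d → ℂ) :
    wienerNorm (β - ε) (advConv u f) ≤
      ENNReal.ofReal (1 / ε) * (vecNorm β u * wienerNorm β f) := by
  refine (wienerNorm_sum_le _ _ _).trans ?_
  rw [vecNorm, Finset.sum_mul, Finset.mul_sum]
  refine Finset.sum_le_sum fun j _ => (wienerNorm_deriv_le hε j _).trans ?_
  gcongr
  exact wienerNorm_conv_le hβ _ _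

/-- A crude `ℓ¹` bound from `|kᵢ| ≤ |k|`; it is linear in the `‖w j‖`, so it can be summed against
the weights directly. -/
lemma norm_leray_le (k : Freq d) (w : Fin d → ℂ) (i : Fin d) :
    ‖leray k w i‖ ≤ ‖w i‖ + ∑ j, ‖w j‖ := by
  unfold leray
  split_ifs with hk
  · rw [norm_zero]; positivity
  · have hpos : 0 < freqNorm k := one_pos.trans_le (one_le_freqNorm hk)
    refine (norm_sub_le _ _).trans (add_le_add le_rfl ?_)
    rw [norm_mul, norm_div, Complex.norm_real, Real.norm_of_nonneg (sq_nonneg _),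
      Complex.norm_intCast, div_mul_eq_mul_div, div_le_iff₀ (by positivity)]
    have h1 : ‖∑ j, (k j : ℂ) * w j‖ ≤ freqNorm k * ∑ j, ‖w j‖ := by
      rw [Finset.mul_sum]
      refine (norm_sum_le _ _).trans (Finset.sum_le_sum fun j _ => ?_)
      rw [norm_mul, Complex.norm_intCast]
      exact mul_le_mul_of_nonneg_right (abs_le_freqNorm k j) (norm_nonneg _)
    calc ‖∑ j, (k j : ℂ) * w j‖ * |(k i : ℝ)|
        ≤ (freqNorm k * ∑ j, ‖w j‖) * freqNorm k :=
          mul_le_mul h1 (abs_le_freqNorm k i) (abs_nonneg _)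
            (mul_nonneg hpos.le (Finset.sum_nonneg fun _ _ => norm_nonneg _))
      _ = _ := by ring

lemma vecNorm_leray_le (β : ℝ) (w : Fin d → Freq d → ℂ) :
    vecNorm β (fun i k => leray k (fun l => w l k) i) ≤ (1 + d) * vecNorm β w := by
  have h : ∀ i, wienerNorm β (fun k => leray k (fun l => w l k) i) ≤
      wienerNorm β (w i) + vecNorm β w := by
    intro i
    have h1 : ∀ k, ‖leray k (fun l => w l k) i‖ₑ ≤ ‖w i k‖ₑ + ∑ j, ‖w j k‖ₑ := by
      intro k
      have := ENNReal.ofReal_le_ofReal (norm_leray_le k (fun l => w l k) i)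
      rw [ENNReal.ofReal_add (norm_nonneg _) (Finset.sum_nonneg fun _ _ => norm_nonneg _),
        ENNReal.ofReal_sum_of_nonneg fun _ _ => norm_nonneg _] at this
      simpa only [ofReal_norm] using this
    unfold vecNorm wienerNorm
    rw [← Summable.tsum_finsetSum fun _ _ => ENNReal.summable, ← ENNReal.tsum_add]
    refine ENNReal.tsum_le_tsum fun k => ?_
    rw [← Finset.mul_sum, ← mul_add]
    gcongr
    exact h1 k
  refine (Finset.sum_le_sum fun i _ => h i).trans (le_of_eq ?_)
  rw [Finset.sum_add_distrib, Finset.sum_const, Finset.card_univ, Fintype.card_fin, nsmul_eq_mul,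
    add_mul, one_mul]
  rfl

lemma vecNorm_add_le (β : ℝ) (u v : Fin d → Freq d → ℂ) :
    vecNorm β (fun i k => u i k + v i k) ≤ vecNorm β u + vecNorm β v := by
  unfold vecNorm
  rw [← Finset.sum_add_distrib]
  exact Finset.sum_le_sum fun i _ => wienerNorm_add_le β _ _

lemma vecNorm_sum_le {ι : Type*} (s : Finset ι) (β : ℝ) (u : ι → Fin d → Freq d → ℂ) :
    vecNorm β (fun i k => ∑ m ∈ s, u m i k) ≤ ∑ m ∈ s, vecNorm β (u m) := by
  unfold vecNorm
  rw [Finset.sum_comm]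
  exact Finset.sum_le_sum fun i _ => wienerNorm_sum_le s β _

lemma vecNorm_mul_left (β : ℝ) (c : ℂ) (u : Fin d → Freq d → ℂ) :
    vecNorm β (fun i k => c * u i k) = ‖c‖ₑ * vecNorm β u := by
  unfold vecNorm
  simp only [wienerNorm_mul_left, Finset.mul_sum]

lemma vecNorm_neg (β : ℝ) (u : Fin d → Freq d → ℂ) :
    vecNorm β (fun i k => -u i k) = vecNorm β u := by
  simp only [vecNorm, wienerNorm_neg]

lemma vecNorm_leray_advConv_le {β ε : ℝ} (hβ : 0 ≤ β) (hε : 0 < ε)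
    (u v : Fin d → Freq d → ℂ) :
    vecNorm (β - ε) (fun i k => leray k (fun l => advConv u (v l) k) i) ≤
      ENNReal.ofReal ((1 + d) / ε) * (vecNorm β u * vecNorm β v) := by
  refine (vecNorm_leray_le _ fun l k => advConv u (v l) k).trans ?_
  have h : vecNorm (β - ε) (fun l k => advConv u (v l) k) ≤
      ENNReal.ofReal (1 / ε) * (vecNorm β u * vecNorm β v) := by
    unfold vecNorm
    rw [Finset.mul_sum, Finset.mul_sum]
    exact Finset.sum_le_sum fun i _ => wienerNorm_advConv_le hβ hε u (v i)
  refine (mul_le_mul_right h _).trans (le_of_eq ?_)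
  rw [← mul_assoc, div_eq_mul_one_div (1 + (d : ℝ)), ENNReal.ofReal_mul (by positivity),
    ENNReal.ofReal_add zero_le_one (by positivity)]
  simp

/-- Buoyancy contains no derivative, so no weight is lost. -/
lemma vecNorm_leray_buoyancy_le (β : ℝ) {g : ℝ} (hg : 0 ≤ g) {e : EuclideanSpace ℝ (Fin d)}
    (he : ‖e‖ = 1) (η : Freq d → ℂ) :
    vecNorm β (fun i k => leray k (fun l => (g : ℂ) * η k * (e l : ℂ)) i) ≤
      ENNReal.ofReal (g * ((1 + d) * d)) * wienerNorm β η := by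
  refine (vecNorm_leray_le _ fun l k => (g : ℂ) * η k * (e l : ℂ)).trans ?_
  have h : vecNorm β (fun l k => (g : ℂ) * η k * (e l : ℂ)) ≤
      d * (ENNReal.ofReal g * wienerNorm β η) := by
    have h1 : ∀ l : Fin d, wienerNorm β (fun k => (g : ℂ) * η k * (e l : ℂ)) ≤
        ENNReal.ofReal g * wienerNorm β η := by
      intro l
      have h2 : (fun k => (g : ℂ) * η k * (e l : ℂ)) = fun k => ((g : ℂ) * (e l : ℂ)) * η k := by
        funext k; ring
      rw [h2, wienerNorm_mul_left]
      gcongr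
      rw [← ofReal_norm]
      refine ENNReal.ofReal_le_ofReal ?_
      rw [norm_mul, Complex.norm_real, Complex.norm_real, Real.norm_of_nonneg hg]
      refine mul_le_of_le_one_right hg ?_
      rw [← he]
      exact PiLp.norm_apply_le e l
    refine (Finset.sum_le_sum fun l _ => h1 l).trans (le_of_eq ?_)
    simp
  refine (mul_le_mul_right h _).trans (le_of_eq ?_)
  rw [ENNReal.ofReal_mul hg, ENNReal.ofReal_mul (by positivity),
    ENNReal.ofReal_add zero_le_one (by positivity)]
  simp only [ENNReal.ofReal_one, ENNReal.ofReal_natCast]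
  ring

/-! ### Taylor coefficients in time -/

/-- The Taylor coefficients in time of the solution of the Boussinesq system with initial Fourier
coefficients `(u₀, η₀)`. -/
def taylorCoeff (g : ℝ) (e : EuclideanSpace ℝ (Fin d)) (u₀ : Fin d → Freq d → ℂ)
    (η₀ : Freq d → ℂ) : ℕ → (Fin d → Freq d → ℂ) × (Freq d → ℂ)
  | 0 => (u₀, η₀)
  | n + 1 =>
    (fun i k => ((n : ℂ) + 1)⁻¹ *
        (leray k (fun l => (g : ℂ) * (taylorCoeff g e u₀ η₀ n).2 k * (e l : ℂ)) i +
          -∑ m : Fin (n + 1), leray k (fun l => advConv (taylorCoeff g e u₀ η₀ m).1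
            ((taylorCoeff g e u₀ η₀ (n - m)).1 l) k) i),
      fun k => ((n : ℂ) + 1)⁻¹ *
        -∑ m : Fin (n + 1), advConv (taylorCoeff g e u₀ η₀ m).1
          (taylorCoeff g e u₀ η₀ (n - m)).2 k)

/-- The Taylor coefficients of the velocity. -/
def velCoeff (g : ℝ) (e : EuclideanSpace ℝ (Fin d)) (u₀ : Fin d → Freq d → ℂ)
    (η₀ : Freq d → ℂ) (n : ℕ) : Fin d → Freq d → ℂ := (taylorCoeff g e u₀ η₀ n).1

/-- The Taylor coefficients of the scalar. -/
def scalCoeff (g : ℝ) (e : EuclideanSpace ℝ (Fin d)) (u₀ : Fin d → Freq d → ℂ)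
    (η₀ : Freq d → ℂ) (n : ℕ) : Freq d → ℂ := (taylorCoeff g e u₀ η₀ n).2

section Recursion

variable (g : ℝ) (e : EuclideanSpace ℝ (Fin d)) (u₀ : Fin d → Freq d → ℂ) (η₀ : Freq d → ℂ)

@[simp] lemma velCoeff_zero : velCoeff g e u₀ η₀ 0 = u₀ := by
  rw [velCoeff, taylorCoeff]

@[simp] lemma scalCoeff_zero : scalCoeff g e u₀ η₀ 0 = η₀ := by
  rw [scalCoeff, taylorCoeff]

/-- The definition sums over `Fin (n + 1)` to make the recursion terminate; estimates and Cauchy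
products use `Finset.range`. -/
lemma velCoeff_succ (n : ℕ) (i : Fin d) (k : Freq d) :
    velCoeff g e u₀ η₀ (n + 1) i k = ((n : ℂ) + 1)⁻¹ *
      (leray k (fun l => (g : ℂ) * scalCoeff g e u₀ η₀ n k * (e l : ℂ)) i +
        -∑ m ∈ Finset.range (n + 1), leray k (fun l => advConv (velCoeff g e u₀ η₀ m)
          (velCoeff g e u₀ η₀ (n - m) l) k) i) := by
  rw [velCoeff, taylorCoeff, ← Fin.sum_univ_eq_sum_range (fun m => leray k (fun l =>
    advConv (velCoeff g e u₀ η₀ m) (velCoeff g e u₀ η₀ (n - m) l) k) i)]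
  rfl

lemma scalCoeff_succ (n : ℕ) (k : Freq d) :
    scalCoeff g e u₀ η₀ (n + 1) k = ((n : ℂ) + 1)⁻¹ *
      -∑ m ∈ Finset.range (n + 1), advConv (velCoeff g e u₀ η₀ m)
        (scalCoeff g e u₀ η₀ (n - m)) k := by
  rw [scalCoeff, taylorCoeff, ← Fin.sum_univ_eq_sum_range (fun m => advConv
    (velCoeff g e u₀ η₀ m) (scalCoeff g e u₀ η₀ (n - m)) k)]
  rfl

lemma enorm_inv_natCast_succ (n : ℕ) :
    ‖((n : ℂ) + 1)⁻¹‖ₑ = ENNReal.ofReal (1 / ((n : ℝ) + 1)) := by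
  rw [← ofReal_norm, norm_inv, one_div]
  congr 2
  exact_mod_cast Complex.norm_natCast (n + 1)

/-- The factor `1 / (n + 1)` is the gain from integrating in time, `1 / ε` the price of the
divergence. -/
lemma wienerNorm_scalCoeff_succ_le {β ε : ℝ} (hβ : 0 ≤ β) (hε : 0 < ε) (n : ℕ) :
    wienerNorm (β - ε) (scalCoeff g e u₀ η₀ (n + 1)) ≤
      ENNReal.ofReal (1 / ((n : ℝ) + 1)) * (ENNReal.ofReal (1 / ε) *
        ∑ m ∈ Finset.range (n + 1), vecNorm β (velCoeff g e u₀ η₀ m) *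
          wienerNorm β (scalCoeff g e u₀ η₀ (n - m))) := by
  have h : scalCoeff g e u₀ η₀ (n + 1) = fun k => ((n : ℂ) + 1)⁻¹ *
      -∑ m ∈ Finset.range (n + 1), advConv (velCoeff g e u₀ η₀ m)
        (scalCoeff g e u₀ η₀ (n - m)) k := funext fun k => scalCoeff_succ g e u₀ η₀ n k
  rw [h, wienerNorm_mul_left, wienerNorm_neg, enorm_inv_natCast_succ, Finset.mul_sum]
  gcongr
  refine (wienerNorm_sum_le _ _ _).trans (Finset.sum_le_sum fun m _ => ?_)
  exact wienerNorm_advConv_le hβ hε _ _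

-- The buoyancy term is measured at the lowered weight `β - ε`, where its majorant is smaller; only
-- the quadratic terms need the weight `β`.
variable {e} in
lemma vecNorm_velCoeff_succ_le (hg : 0 ≤ g) (he : ‖e‖ = 1) {β ε : ℝ} (hβ : 0 ≤ β) (hε : 0 < ε)
    (n : ℕ) :
    vecNorm (β - ε) (velCoeff g e u₀ η₀ (n + 1)) ≤
      ENNReal.ofReal (1 / ((n : ℝ) + 1)) * (ENNReal.ofReal (g * ((1 + d) * d)) *
        wienerNorm (β - ε) (scalCoeff g e u₀ η₀ n) + ENNReal.ofReal ((1 + d) / ε) *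
          ∑ m ∈ Finset.range (n + 1), vecNorm β (velCoeff g e u₀ η₀ m) *
            vecNorm β (velCoeff g e u₀ η₀ (n - m))) := by
  have h : velCoeff g e u₀ η₀ (n + 1) = fun i k => ((n : ℂ) + 1)⁻¹ *
      (leray k (fun l => (g : ℂ) * scalCoeff g e u₀ η₀ n k * (e l : ℂ)) i +
        -∑ m ∈ Finset.range (n + 1), leray k (fun l => advConv (velCoeff g e u₀ η₀ m)
          (velCoeff g e u₀ η₀ (n - m) l) k) i) :=
    funext fun i => funext fun k => velCoeff_succ g e u₀ η₀ n i k
  rw [h, vecNorm_mul_left, enorm_inv_natCast_succ, Finset.mul_sum]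
  gcongr
  refine (vecNorm_add_le _ _ _).trans (add_le_add
    (vecNorm_leray_buoyancy_le _ hg he _) ?_)
  rw [vecNorm_neg]
  refine (vecNorm_sum_le _ _ _).trans (Finset.sum_le_sum fun m _ => ?_)
  exact vecNorm_leray_advConv_le hβ hε _ _

end Recursion

/-! ### Majorants for the Taylor coefficients -/

/-- Telescoping of `1 / (n + 1)² ≤ 1 / n - 1 / (n + 1)`. For `n = 0` the convention `1 / 0 = 0`
makes the bound `0 ≤ 2`. -/
lemma sum_inv_sq_le (n : ℕ) :
    ∑ m ∈ Finset.range n, 1 / ((m : ℝ) + 1) ^ 2 ≤ 2 - 1 / (n : ℝ) := by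
  induction n with
  | zero => simp
  | succ n ih =>
    rw [Finset.sum_range_succ]
    rcases Nat.eq_zero_or_pos n with rfl | hn
    · norm_num
    · have hn' : (0 : ℝ) < n := Nat.cast_pos.2 hn
      have h : 1 / ((n : ℝ) + 1) ^ 2 ≤ 1 / (n : ℝ) - 1 / ((n : ℝ) + 1) := by
        rw [div_sub_div _ _ hn'.ne' (by positivity), div_le_div_iff₀ (by positivity) (by positivity)]
        nlinarith
      push_cast
      linarith

/-- With `a = m + 1` and `b = n - m + 1` one has `a + b = n + 2`, and `(a + b)² ≤ 2 (a² + b²)`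
splits each product into two separate inverse squares. Each resulting sum is at most `2`. -/
lemma sum_inv_sq_mul_inv_sq_le (n : ℕ) :
    ∑ m ∈ Finset.range (n + 1), 1 / ((m : ℝ) + 1) ^ 2 * (1 / (((n - m : ℕ) : ℝ) + 1) ^ 2) ≤
      8 / ((n : ℝ) + 2) ^ 2 := by
  have hterm : ∀ m ∈ Finset.range (n + 1),
      1 / ((m : ℝ) + 1) ^ 2 * (1 / (((n - m : ℕ) : ℝ) + 1) ^ 2) ≤
        2 / ((n : ℝ) + 2) ^ 2 * (1 / ((m : ℝ) + 1) ^ 2 + 1 / (((n - m : ℕ) : ℝ) + 1) ^ 2) := by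
    intro m hm
    have hn : (n : ℝ) = m + ((n - m : ℕ) : ℝ) := by
      rw [← Nat.cast_add, Nat.add_sub_cancel' (Nat.lt_succ_iff.1 (Finset.mem_range.1 hm))]
    have key : ∀ x y : ℝ, 0 ≤ x → 0 ≤ y → 1 / (x + 1) ^ 2 * (1 / (y + 1) ^ 2) ≤
        2 / (x + y + 2) ^ 2 * (1 / (x + 1) ^ 2 + 1 / (y + 1) ^ 2) := by
      intro x y hx hy
      rw [div_add_div _ _ (by positivity) (by positivity), div_mul_div_comm, div_mul_div_comm,
        div_le_div_iff₀ (by positivity) (by positivity)]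
      have h : (x + y + 2) ^ 2 ≤ 2 * ((y + 1) ^ 2 + (x + 1) ^ 2) := by nlinarith [sq_nonneg (x - y)]
      nlinarith [mul_le_mul_of_nonneg_right h
        (by positivity : 0 ≤ (x + 1) ^ 2 * (y + 1) ^ 2)]
    rw [hn]
    exact key _ _ (Nat.cast_nonneg _) (Nat.cast_nonneg _)
  refine (Finset.sum_le_sum hterm).trans ?_
  rw [← Finset.mul_sum, Finset.sum_add_distrib]
  have h1 : ∑ m ∈ Finset.range (n + 1), 1 / (((n - m : ℕ) : ℝ) + 1) ^ 2 =
      ∑ m ∈ Finset.range (n + 1), 1 / ((m : ℝ) + 1) ^ 2 := by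
    have := Finset.sum_range_reflect (fun m : ℕ => 1 / ((m : ℝ) + 1) ^ 2) (n + 1)
    simpa using this
  have h2 : ∑ m ∈ Finset.range (n + 1), 1 / ((m : ℝ) + 1) ^ 2 ≤ 2 :=
    (sum_inv_sq_le (n + 1)).trans (by
      have : (0 : ℝ) ≤ 1 / ((n + 1 : ℕ) : ℝ) := by positivity
      linarith)
  rw [h1]
  calc _ ≤ 2 / ((n : ℝ) + 2) ^ 2 * (2 + 2) := by gcongr
    _ = _ := by ring

/-- The price of shrinking `δ` to `δ (n + 1) / (n + 2)` in an `n`-th power stays below `exp 1`,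
uniformly in `n`. -/
lemma one_add_inv_pow_le (n : ℕ) : (((n : ℝ) + 2) / (n + 1)) ^ n ≤ 4 := by
  have h1 : ((n : ℝ) + 2) / (n + 1) ≤ Real.exp (1 / (n + 1)) := by
    refine le_trans (le_of_eq ?_) (Real.add_one_le_exp _)
    field_simp
    ring
  calc (((n : ℝ) + 2) / (n + 1)) ^ n ≤ Real.exp (1 / (n + 1)) ^ n := by gcongr
    _ = Real.exp (n / (n + 1)) := by rw [← Real.exp_nat_mul]; ring_nf
    _ ≤ Real.exp 1 := by
        refine Real.exp_le_exp.2 ((div_le_one (by positivity)).2 (by linarith))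
    _ ≤ 4 := by linarith [Real.exp_one_lt_d9]

/-- The majorant for the `n`-th Taylor coefficient in the norm with weight lowered by `δ`. -/
def majorant (c : ℝ) (n : ℕ) (δ : ℝ) : ℝ := 1 / ((n : ℝ) + 1) ^ 2 * (c / δ) ^ n

lemma majorant_nonneg {c δ : ℝ} (hc : 0 ≤ c) (hδ : 0 ≤ δ) (n : ℕ) : 0 ≤ majorant c n δ := by
  unfold majorant
  positivity

lemma majorant_succ (c : ℝ) (n : ℕ) (δ : ℝ) :
    majorant c (n + 1) δ = 1 / ((n : ℝ) + 2) ^ 2 * ((c / δ) ^ n * (c / δ)) := by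
  unfold majorant
  rw [pow_succ]
  push_cast
  ring

/-- The quadratic terms of the recursion preserve the majorants. -/
lemma sum_majorant_mul_le {c δ : ℝ} (hc : 0 < c) (hδ : 0 < δ) (n : ℕ) :
    1 / ((n : ℝ) + 1) * (1 / (δ / (n + 2)) * ∑ m ∈ Finset.range (n + 1),
      majorant c m (δ - δ / (n + 2)) * majorant c (n - m) (δ - δ / (n + 2))) ≤
      64 / c * majorant c (n + 1) δ := by
  have hd : δ - δ / ((n : ℝ) + 2) = δ * ((n + 1) / (n + 2)) := by field_simp; ring
  have hsum : ∑ m ∈ Finset.range (n + 1),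
      majorant c m (δ - δ / (n + 2)) * majorant c (n - m) (δ - δ / (n + 2)) =
      (∑ m ∈ Finset.range (n + 1), 1 / ((m : ℝ) + 1) ^ 2 * (1 / (((n - m : ℕ) : ℝ) + 1) ^ 2)) *
        ((c / δ) ^ n * (((n : ℝ) + 2) / (n + 1)) ^ n) := by
    rw [Finset.sum_mul]
    refine Finset.sum_congr rfl fun m hm => ?_
    have hn : m + (n - m) = n := Nat.add_sub_cancel' (Nat.lt_succ_iff.1 (Finset.mem_range.1 hm))
    have hx : c / (δ - δ / ((n : ℝ) + 2)) = c / δ * (((n : ℝ) + 2) / (n + 1)) := by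
      rw [hd]; field_simp
    unfold majorant
    rw [hx, mul_mul_mul_comm, ← pow_add, hn, mul_pow]
  rw [hsum]
  -- The constant `64` is `8 · 4 · 2`: the convolution sum, the shrunken `δ`, and `(n + 2) / (n + 1)
  -- ≤ 2`.
  calc 1 / ((n : ℝ) + 1) * (1 / (δ / (n + 2)) *
      ((∑ m ∈ Finset.range (n + 1), 1 / ((m : ℝ) + 1) ^ 2 * (1 / (((n - m : ℕ) : ℝ) + 1) ^ 2)) *
        ((c / δ) ^ n * (((n : ℝ) + 2) / (n + 1)) ^ n)))
      ≤ 1 / ((n : ℝ) + 1) * (1 / (δ / (n + 2)) * (8 / ((n : ℝ) + 2) ^ 2 * ((c / δ) ^ n * 4))) := by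
        gcongr
        · exact sum_inv_sq_mul_inv_sq_le n
        · exact one_add_inv_pow_le n
    _ = (((n : ℝ) + 2) / (n + 1)) * (32 / δ * (c / δ) ^ n * (1 / ((n : ℝ) + 2) ^ 2)) := by
        field_simp; ring
    _ ≤ 2 * (32 / δ * (c / δ) ^ n * (1 / ((n : ℝ) + 2) ^ 2)) := by
        gcongr
        rw [div_le_iff₀ (by positivity)]
        have : (0 : ℝ) ≤ n := Nat.cast_nonneg n
        linarith
    _ = _ := by
        rw [majorant_succ]
        generalize (c / δ) ^ n = z
        field_simp
        ring

/-- The linear term of the recursion preserves the majorants. -/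
lemma inv_mul_majorant_le {c δ : ℝ} (hc : 0 < c) (hδ : 0 < δ) (n : ℕ) :
    1 / ((n : ℝ) + 1) * majorant c n δ ≤ 4 * δ / c * majorant c (n + 1) δ := by
  have h : 1 / ((n : ℝ) + 1) * (1 / ((n : ℝ) + 1) ^ 2) ≤ 4 * (1 / ((n : ℝ) + 2) ^ 2) := by
    rw [div_mul_div_comm, mul_one_div, div_le_div_iff₀ (by positivity) (by positivity)]
    have : (0 : ℝ) ≤ n := Nat.cast_nonneg n
    nlinarith [pow_nonneg this 3, sq_nonneg (n : ℝ)]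
  calc 1 / ((n : ℝ) + 1) * majorant c n δ
      = 1 / ((n : ℝ) + 1) * (1 / ((n : ℝ) + 1) ^ 2) * (c / δ) ^ n := by unfold majorant; ring
    _ ≤ 4 * (1 / ((n : ℝ) + 2) ^ 2) * (c / δ) ^ n := by gcongr
    _ = _ := by
        rw [majorant_succ]
        generalize (c / δ) ^ n = z
        field_simp

variable {g : ℝ} {e : EuclideanSpace ℝ (Fin d)} {u₀ : Fin d → Freq d → ℂ} {η₀ : Freq d → ℂ}

/-- Strong induction, uniform in `δ`, because each step calls the earlier bounds at the smaller loss
`δ - ε`. The extra factor `A` in the velocity bound leaves room for the buoyancy: `h1` makes that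
term at most half of the velocity majorant, and `h2` does the same for the quadratic term. -/
lemma taylorCoeff_bounds (hg : 0 ≤ g) (he : ‖e‖ = 1) {β₀ A N c : ℝ} (hA : 0 ≤ A) (hN : 0 ≤ N)
    (hc : 0 < c) (hu : vecNorm β₀ u₀ ≤ ENNReal.ofReal (A * N))
    (hη : wienerNorm β₀ η₀ ≤ ENNReal.ofReal N) (h1 : 8 * (g * ((1 + d) * d)) * β₀ ≤ A * c)
    (h2 : 128 * (1 + d) * A * N ≤ c) (n : ℕ) :
    ∀ δ, 0 < δ → δ ≤ β₀ →
      wienerNorm (β₀ - δ) (scalCoeff g e u₀ η₀ n) ≤ ENNReal.ofReal (N * majorant c n δ) ∧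
      vecNorm (β₀ - δ) (velCoeff g e u₀ η₀ n) ≤ ENNReal.ofReal (A * N * majorant c n δ) := by
  have hAN : 0 ≤ A * N := mul_nonneg hA hN
  induction n using Nat.strong_induction_on with
  | _ n ih =>
  intro δ hδ hδβ
  rcases n with _ | n
  · have hm : majorant c 0 δ = 1 := by simp [majorant]
    rw [hm, mul_one, mul_one, scalCoeff_zero, velCoeff_zero]
    exact ⟨(wienerNorm_mono (by linarith) _).trans hη,
      (Finset.sum_le_sum fun i _ => wienerNorm_mono (by linarith) _).trans hu⟩
  -- A loss of order `δ / n` balances `1 / ε` against `1 / (n + 1)`; the shift by `2` keeps `ε < δ`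
  -- also for `n = 0`.
  set ε : ℝ := δ / (n + 2) with hε_def
  have hε : 0 < ε := by positivity
  have hεδ : ε < δ := div_lt_self hδ (by linarith [(Nat.cast_nonneg n : (0 : ℝ) ≤ n)])
  have hβ : 0 ≤ β₀ - (δ - ε) := by linarith
  have hsplit : β₀ - δ = β₀ - (δ - ε) - ε := by ring
  have hM : ∀ m, 0 ≤ majorant c m (δ - ε) := majorant_nonneg hc.le (by linarith)
  have hMδ : ∀ m, 0 ≤ majorant c m δ := majorant_nonneg hc.le hδ.le
  have hle : ∀ m ∈ Finset.range (n + 1), m < n + 1 ∧ n - m < n + 1 := fun m hm =>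
    ⟨Finset.mem_range.1 hm, by omega⟩
  have hquad := sum_majorant_mul_le hc hδ n
  rw [← hε_def] at hquad
  constructor
  · rw [hsplit]
    refine (wienerNorm_scalCoeff_succ_le g e u₀ η₀ hβ hε n).trans ?_
    calc _ ≤ ENNReal.ofReal (1 / ((n : ℝ) + 1)) * (ENNReal.ofReal (1 / ε) *
          ∑ m ∈ Finset.range (n + 1), ENNReal.ofReal (A * N * majorant c m (δ - ε)) *
            ENNReal.ofReal (N * majorant c (n - m) (δ - ε))) := by
          gcongr with m hm
          · exact (ih m (hle m hm).1 (δ - ε) (by linarith) (by linarith)).2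
          · exact (ih (n - m) (hle m hm).2 (δ - ε) (by linarith) (by linarith)).1
      _ = ENNReal.ofReal (A * N * N * (1 / ((n : ℝ) + 1) * (1 / ε *
          ∑ m ∈ Finset.range (n + 1), majorant c m (δ - ε) * majorant c (n - m) (δ - ε)))) := by
          simp_rw [← ENNReal.ofReal_mul (mul_nonneg hAN (hM _))]
          rw [← ENNReal.ofReal_sum_of_nonneg fun m _ =>
              mul_nonneg (mul_nonneg hAN (hM _)) (mul_nonneg hN (hM _)),
            ← ENNReal.ofReal_mul (by positivity), ← ENNReal.ofReal_mul (by positivity)]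
          congr 1
          simp only [Finset.mul_sum]
          exact Finset.sum_congr rfl fun m _ => by ring
      _ ≤ _ := by
          refine ENNReal.ofReal_le_ofReal ?_
          have h3 : A * N * (64 / c) ≤ 1 := by
            rw [mul_div_assoc', div_le_one hc]
            have : (0 : ℝ) ≤ d * (A * N) := by positivity
            nlinarith
          calc A * N * N * _ ≤ A * N * N * (64 / c * majorant c (n + 1) δ) := by gcongr
            _ = (A * N * (64 / c)) * (N * majorant c (n + 1) δ) := by ring
            _ ≤ 1 * (N * majorant c (n + 1) δ) :=
                mul_le_mul_of_nonneg_right h3 (mul_nonneg hN (hMδ _))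
            _ = _ := one_mul _
  · rw [hsplit]
    refine (vecNorm_velCoeff_succ_le g u₀ η₀ hg he hβ hε n).trans ?_
    -- This returns the buoyancy term to weight `β₀ - δ`, so the induction hypothesis applies to it
    -- with `δ` itself.
    rw [← hsplit]
    calc _ ≤ ENNReal.ofReal (1 / ((n : ℝ) + 1)) * (ENNReal.ofReal (g * ((1 + d) * d)) *
          ENNReal.ofReal (N * majorant c n δ) + ENNReal.ofReal ((1 + d) / ε) *
          ∑ m ∈ Finset.range (n + 1), ENNReal.ofReal (A * N * majorant c m (δ - ε)) *
            ENNReal.ofReal (A * N * majorant c (n - m) (δ - ε))) := by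
          gcongr with m hm
          · exact (ih n (Nat.lt_succ_self n) δ hδ hδβ).1
          · exact (ih m (hle m hm).1 (δ - ε) (by linarith) (by linarith)).2
          · exact (ih (n - m) (hle m hm).2 (δ - ε) (by linarith) (by linarith)).2
      _ = ENNReal.ofReal (g * ((1 + d) * d) * N * (1 / ((n : ℝ) + 1) * majorant c n δ) +
          (1 + d) * (A * N) * (A * N) * (1 / ((n : ℝ) + 1) * (1 / ε *
          ∑ m ∈ Finset.range (n + 1), majorant c m (δ - ε) * majorant c (n - m) (δ - ε)))) := by
          simp_rw [← ENNReal.ofReal_mul (mul_nonneg hAN (hM _))]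
          rw [← ENNReal.ofReal_sum_of_nonneg fun m _ =>
              mul_nonneg (mul_nonneg hAN (hM _)) (mul_nonneg hAN (hM _)),
            ← ENNReal.ofReal_mul (by positivity), ← ENNReal.ofReal_mul (by positivity),
            ← ENNReal.ofReal_add (mul_nonneg (by positivity) (mul_nonneg hN (hMδ _)))
              (mul_nonneg (by positivity) (Finset.sum_nonneg fun m _ =>
                mul_nonneg (mul_nonneg hAN (hM _)) (mul_nonneg hAN (hM _)))),
            ← ENNReal.ofReal_mul (by positivity)]
          congr 1
          rw [mul_add]
          congr 1
          · ring
          · simp only [Finset.mul_sum]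
            exact Finset.sum_congr rfl fun m _ => by ring
      _ ≤ _ := by
          refine ENNReal.ofReal_le_ofReal ?_
          have h3 : g * ((1 + d) * d) * (4 * δ / c) ≤ A / 2 := by
            rw [mul_div_assoc', div_le_iff₀ hc]
            have : g * ((1 + d) * d) * δ ≤ g * ((1 + d) * d) * β₀ := by gcongr
            linarith
          have h4 : (1 + d) * (A * N) * (64 / c) ≤ 1 / 2 := by
            rw [mul_div_assoc', div_le_iff₀ hc]
            linarith
          have hmul : 0 ≤ N * majorant c (n + 1) δ := mul_nonneg hN (hMδ _)
          calc _ ≤ g * ((1 + d) * d) * N * (4 * δ / c * majorant c (n + 1) δ) +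
                (1 + d) * (A * N) * (A * N) * (64 / c * majorant c (n + 1) δ) := by
                gcongr ?_ * ?_ + ?_ * ?_
                exact inv_mul_majorant_le hc hδ n
            _ = (g * ((1 + d) * d) * (4 * δ / c)) * (N * majorant c (n + 1) δ) +
                ((1 + d) * (A * N) * (64 / c)) * (A * (N * majorant c (n + 1) δ)) := by ring
            _ ≤ A / 2 * (N * majorant c (n + 1) δ) +
                1 / 2 * (A * (N * majorant c (n + 1) δ)) := by gcongr
            _ = _ := by ring

/-- On every disc of radius `s < β₀ / c` the Taylor series converge in some weighted Wiener
algebra. -/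
lemma exists_tsum_taylorCoeff_lt_top (hg : 0 ≤ g) (he : ‖e‖ = 1) {β₀ A N c : ℝ} (hA : 0 ≤ A) (hN : 0 ≤ N)
    (hc : 0 < c) (hu : vecNorm β₀ u₀ ≤ ENNReal.ofReal (A * N))
    (hη : wienerNorm β₀ η₀ ≤ ENNReal.ofReal N) (h1 : 8 * (g * ((1 + d) * d)) * β₀ ≤ A * c)
    (h2 : 128 * (1 + d) * A * N ≤ c) {s : ℝ} (hs : 0 ≤ s) (hsc : s < β₀ / c) :
    ∃ β, 0 < β ∧
      ∑' n, ENNReal.ofReal (s ^ n) * wienerNorm β (scalCoeff g e u₀ η₀ n) < ∞ ∧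
      ∀ i, ∑' n, ENNReal.ofReal (s ^ n) * wienerNorm β (velCoeff g e u₀ η₀ n i) < ∞ := by
  -- `δ > s c` gives a geometric ratio below `1`; `δ < β₀` leaves the positive weight `β₀ - δ`.
  obtain ⟨δ, hδ1, hδ2⟩ : ∃ δ, s * c < δ ∧ δ < β₀ := exists_between ((lt_div_iff₀ hc).1 hsc)
  have hδ : 0 < δ := (mul_nonneg hs hc.le).trans_lt hδ1
  set q := s * (c / δ) with hq
  have hq0 : 0 ≤ q := by positivity
  have hq1 : q < 1 := by
    rw [hq, mul_div_assoc', div_lt_one hδ]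
    exact hδ1
  have key : ∀ (B : ℝ) (W : ℕ → ℝ≥0∞), 0 ≤ B →
      (∀ n, W n ≤ ENNReal.ofReal (B * majorant c n δ)) →
      ∑' n, ENNReal.ofReal (s ^ n) * W n < ∞ := by
    intro B W hB hW
    have hsum : Summable fun n : ℕ => B * q ^ n :=
      (summable_geometric_of_lt_one hq0 hq1).mul_left B
    refine lt_of_le_of_lt (ENNReal.tsum_le_tsum fun n => ?_)
      (lt_top_iff_ne_top.2 hsum.tsum_ofReal_ne_top)
    refine (mul_le_mul_right (hW n) _).trans ?_
    rw [← ENNReal.ofReal_mul (by positivity)]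
    refine ENNReal.ofReal_le_ofReal ?_
    have hle : majorant c n δ ≤ (c / δ) ^ n := by
      unfold majorant
      refine mul_le_of_le_one_left (by positivity) ?_
      rw [div_le_one (by positivity)]
      exact one_le_pow₀ (by linarith [(Nat.cast_nonneg n : (0 : ℝ) ≤ n)])
    calc s ^ n * (B * majorant c n δ) ≤ s ^ n * (B * (c / δ) ^ n) := by gcongr
      _ = B * q ^ n := by rw [hq, mul_pow]; ring
  have hb := fun n => taylorCoeff_bounds hg he hA hN hc hu hη h1 h2 n δ hδ hδ2.le
  refine ⟨β₀ - δ, by linarith, key N _ hN fun n => (hb n).1, fun i =>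
    key (A * N) _ (by positivity) fun n => le_trans ?_ (hb n).2⟩
  exact Finset.single_le_sum (f := fun i => wienerNorm (β₀ - δ) (velCoeff g e u₀ η₀ n i))
    (fun _ _ => zero_le) (Finset.mem_univ i)

/-! ### Power series in time with values in `L²` -/

/-- The Cauchy product of two absolutely convergent series under a bounded bilinear map. -/
lemma hasSum_bilinear_cauchyProduct {E F G : Type*} [NormedAddCommGroup E] [NormedSpace ℂ E]
    [CompleteSpace E] [NormedAddCommGroup F] [NormedSpace ℂ F] [CompleteSpace F]
    [NormedAddCommGroup G] [NormedSpace ℂ G] [CompleteSpace G] (B : E →L[ℂ] F →L[ℂ] G)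
    {f : ℕ → E} {g : ℕ → F} (hf : Summable fun n => ‖f n‖) (hg : Summable fun n => ‖g n‖) :
    HasSum (fun n => ∑ m ∈ Finset.range (n + 1), B (f m) (g (n - m)))
      (B (∑' n, f n) (∑' n, g n)) := by
  have hprod : Summable fun p : ℕ × ℕ => B (f p.1) (g p.2) := by
    refine Summable.of_norm_bounded
      ((hf.mul_of_nonneg hg (fun _ => norm_nonneg _) fun _ => norm_nonneg _).mul_left ‖B‖)
      fun p => ?_
    rw [← mul_assoc]
    exact B.le_opNorm₂ _ _
  have hval : ∑' p : ℕ × ℕ, B (f p.1) (g p.2) = B (∑' n, f n) (∑' n, g n) := by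
    rw [hprod.tsum_prod]
    have h1 := (B.flip (∑' n, g n)).hasSum hf.of_norm.hasSum
    rw [ContinuousLinearMap.flip_apply] at h1
    rw [← h1.tsum_eq]
    exact tsum_congr fun m => ((B (f m)).hasSum hg.of_norm.hasSum).tsum_eq
  have hsum := hprod.hasSum
  rw [hval, ← Finset.HasAntidiagonal.sigmaAntidiagonalEquivProd.hasSum_iff] at hsum
  have h2 := hsum.sigma fun n => hasSum_fintype _
  refine h2.congr_fun fun n => ?_
  rw [← Finset.Nat.sum_antidiagonal_eq_sum_range_succ (fun i j => B (f i) (g j)) n]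
  simp only [Function.comp_apply, Finset.HasAntidiagonal.sigmaAntidiagonalEquivProd_apply]
  exact (Finset.sum_coe_sort (Finset.HasAntidiagonal.antidiagonal n) fun p => B (f p.1) (g p.2)).symm

/-- The `L²` function `∑ ζ ^ n a_n`, where `a_n` is given by its Fourier coefficients. -/
def timeSeries (a : ℕ → Freq d → ℂ) (ζ : ℂ) : L2 d := ∑' n, ζ ^ n • ofCoeff (a n)

/-- Convergence of a power series in time, on the closed disc of radius `s`, in a weighted Wiener
algebra. -/
def SeriesBound (β s : ℝ) (a : ℕ → Freq d → ℂ) : Prop :=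
  ∑' n, ENNReal.ofReal (s ^ n) * wienerNorm β (a n) < ∞

section Series

variable {β s : ℝ} {a b : ℕ → Freq d → ℂ}

lemma SeriesBound.wienerNorm_ne_top (h : SeriesBound β s a) (hs : 0 < s) (n : ℕ) :
    wienerNorm β (a n) ≠ ∞ := by
  intro htop
  have h1 := ENNReal.ne_top_of_tsum_ne_top h.ne n
  rw [htop] at h1
  exact h1 (ENNReal.mul_top (by simpa using pow_pos hs n))

lemma SeriesBound.summable_norm_coeff (h : SeriesBound β s a) (hβ : 0 ≤ β) (hs : 0 < s) (n : ℕ) :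
    Summable fun k => ‖a n k‖ :=
  summable_norm_of_wienerNorm_ne_top hβ (h.wienerNorm_ne_top hs n)

lemma SeriesBound.summable (h : SeriesBound β s a) (hβ : 0 ≤ β) (hs : 0 < s) :
    Summable fun n => s ^ n * ‖ofCoeff (a n)‖ := by
  obtain ⟨M, hM0, hM⟩ := exists_norm_ofCoeff_le d
  refine Summable.of_nonneg_of_le (fun n => by positivity) (fun n => ?_)
    ((ENNReal.summable_toReal h.ne).mul_left M)
  rw [ENNReal.toReal_mul, ENNReal.toReal_ofReal (by positivity)]
  have h1 := (hM (a n) (h.summable_norm_coeff hβ hs n)).trans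
    (mul_le_mul_of_nonneg_left (tsum_norm_le_toReal_wienerNorm hβ (h.wienerNorm_ne_top hs n)) hM0)
  calc s ^ n * ‖ofCoeff (a n)‖ ≤ s ^ n * (M * (wienerNorm β (a n)).toReal) := by gcongr
    _ = _ := by ring

lemma norm_pow_smul_le {ζ : ℂ} (hζ : ‖ζ‖ ≤ s) (n : ℕ) (x : L2 d) :
    ‖ζ ^ n • x‖ ≤ s ^ n * ‖x‖ := by
  rw [norm_smul, norm_pow]
  gcongr

lemma SeriesBound.summable_norm (h : SeriesBound β s a) (hβ : 0 ≤ β) (hs : 0 < s) {ζ : ℂ}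
    (hζ : ‖ζ‖ ≤ s) : Summable fun n => ‖ζ ^ n • ofCoeff (a n)‖ :=
  Summable.of_nonneg_of_le (fun _ => norm_nonneg _) (fun n => norm_pow_smul_le hζ n _)
    (h.summable hβ hs)

lemma SeriesBound.hasSum (h : SeriesBound β s a) (hβ : 0 ≤ β) (hs : 0 < s) {ζ : ℂ}
    (hζ : ‖ζ‖ ≤ s) : HasSum (fun n => ζ ^ n • ofCoeff (a n)) (timeSeries a ζ) :=
  (h.summable_norm hβ hs hζ).of_norm.hasSum

lemma SeriesBound.differentiableOn (h : SeriesBound β s a) (hβ : 0 ≤ β) (hs : 0 < s) :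
    DifferentiableOn ℂ (timeSeries a) (Metric.ball 0 s) :=
  Complex.differentiableOn_tsum_of_summable_norm (h.summable hβ hs)
    (fun n => by fun_prop) Metric.isOpen_ball
    fun n _ hw => norm_pow_smul_le (mem_ball_zero_iff.1 hw).le n _

lemma SeriesBound.hasSum_coeff (h : SeriesBound β s a) (hβ : 0 ≤ β) (hs : 0 < s) {ζ : ℂ}
    (hζ : ‖ζ‖ ≤ s) (k : Freq d) :
    HasSum (fun n => ζ ^ n * a n k) (coeff (timeSeries a ζ) k) := by
  have h1 := (coeffL k).hasSum (h.hasSum hβ hs hζ)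
  rw [coeffL_apply] at h1
  refine h1.congr_fun fun n => ?_
  rw [map_smul, smul_eq_mul, coeffL_apply, coeff_ofCoeff (h.summable_norm_coeff hβ hs n)]

lemma SeriesBound.hasSum_coeff_deriv (h : SeriesBound β s a) (hβ : 0 ≤ β) (hs : 0 < s) {ζ : ℂ}
    (hζ : ‖ζ‖ < s) (k : Freq d) :
    HasSum (fun n : ℕ => ζ ^ n * (((n : ℂ) + 1) * a (n + 1) k))
      (coeff (⇑(deriv (timeSeries a) ζ)) k) := by
  have h0 := Complex.hasSum_deriv_of_summable_norm (F := fun n (ζ : ℂ) => ζ ^ n • ofCoeff (a n))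
    (h.summable hβ hs) (fun n => by fun_prop)
    Metric.isOpen_ball (fun n _ hw => norm_pow_smul_le (mem_ball_zero_iff.1 hw).le n _)
    (mem_ball_zero_iff.2 hζ)
  have h1 := (coeffL k).hasSum h0
  rw [coeffL_apply] at h1
  -- The constant term has zero derivative, so the index can be shifted by one.
  have h2 := (hasSum_nat_add_iff' 1).2 h1
  have hterm : ∀ n : ℕ, coeffL k (deriv (fun ζ : ℂ => ζ ^ n • ofCoeff (a n)) ζ) =
      n * ζ ^ (n - 1) * a n k := by
    intro n
    rw [deriv_smul_const (by fun_prop), map_smul, smul_eq_mul, coeffL_apply,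
      coeff_ofCoeff (h.summable_norm_coeff hβ hs n)]
    simp
  simp only [Finset.sum_range_one, hterm, Nat.cast_zero, zero_mul, sub_zero] at h2
  refine h2.congr_fun fun n => ?_
  simp only [Nat.add_sub_cancel]
  push_cast
  ring

lemma SeriesBound.hasSum_prodCoeffL (ha : SeriesBound β s a) (hb : SeriesBound β s b)
    (hβ : 0 ≤ β) (hs : 0 < s) {ζ : ℂ} (hζ : ‖ζ‖ ≤ s) (k : Freq d) :
    HasSum (fun n => ζ ^ n * ∑ m ∈ Finset.range (n + 1), conv (a m) (b (n - m)) k)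
      (prodCoeffL k (timeSeries a ζ) (timeSeries b ζ)) := by
  refine (hasSum_bilinear_cauchyProduct (prodCoeffL k) (ha.summable_norm hβ hs hζ)
    (hb.summable_norm hβ hs hζ)).congr_fun fun n => ?_
  rw [Finset.mul_sum]
  refine Finset.sum_congr rfl fun m hm => ?_
  rw [map_smul, map_smul, _root_.smul_apply, smul_eq_mul, smul_eq_mul,
    prodCoeffL_ofCoeff (ha.summable_norm_coeff hβ hs m) (hb.summable_norm_coeff hβ hs (n - m)),
    ← mul_assoc, ← pow_add]
  congr 2
  have := Finset.mem_range.1 hm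
  omega

lemma timeSeries_zero (a : ℕ → Freq d → ℂ) : timeSeries a 0 = ofCoeff (a 0) := by
  rw [timeSeries, tsum_eq_single 0]
  · simp
  · intro n hn
    simp [hn]

/-- Half of the exponential weight absorbs `|k| ^ r`: raise `y ≤ exp y` with `y = β |k| / (2r)` to
the power `r`. -/
lemma exists_gevreyWeight_le (d : ℕ) {r β : ℝ} (hr : 0 < r) (hβ : 0 < β) :
    ∃ K : ℝ, 0 ≤ K ∧ ∀ k : Freq d,
      gevreyWeight r (β / 2) k ≤ K * Real.exp (β * freqNorm k) := by
  refine ⟨(2 * r / β) ^ r, by positivity, fun k => ?_⟩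
  have hx := freqNorm_nonneg k
  have h1 : freqNorm k ^ r ≤ (2 * r / β) ^ r * Real.exp (β / 2 * freqNorm k) := by
    have h2 : freqNorm k = (2 * r / β) * (β / (2 * r) * freqNorm k) := by field_simp
    have h3 : (β / (2 * r) * freqNorm k) ^ r ≤ Real.exp (β / 2 * freqNorm k) := by
      calc (β / (2 * r) * freqNorm k) ^ r ≤ Real.exp (β / (2 * r) * freqNorm k) ^ r := by
            refine Real.rpow_le_rpow (by positivity) ?_ hr.le
            linarith [Real.add_one_le_exp (β / (2 * r) * freqNorm k)]
        _ = Real.exp (β / 2 * freqNorm k) := by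
            rw [← Real.exp_mul]
            congr 1
            field_simp
    calc freqNorm k ^ r = (2 * r / β) ^ r * (β / (2 * r) * freqNorm k) ^ r := by
          rw [← Real.mul_rpow (by positivity) (by positivity), ← h2]
      _ ≤ _ := by gcongr
  calc gevreyWeight r (β / 2) k
      ≤ (2 * r / β) ^ r * Real.exp (β / 2 * freqNorm k) * Real.exp (β / 2 * freqNorm k) := by
        unfold gevreyWeight; gcongr
    _ = _ := by
        rw [mul_assoc, ← Real.exp_add]
        ring_nf

/-- Applying the Gevrey symbol with weight `β / 2` to every Taylor coefficient leaves a series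
bounded in the unweighted Wiener norm, hence holomorphic in `L²` on the same disc. -/
lemma SeriesBound.gevreyHolomorphicAt (h : SeriesBound β s a) (hβ : 0 < β) (hs : 0 < s) {r : ℝ}
    (hr : 0 < r) {ζ₀ : ℂ} (hζ₀ : ‖ζ₀‖ < s) : GevreyHolomorphicAt r (timeSeries a) ζ₀ := by
  obtain ⟨K, hK0, hK⟩ := exists_gevreyWeight_le d hr hβ
  set a' : ℕ → Freq d → ℂ := fun n k => (gevreyWeight r (β / 2) k : ℂ) * a n k with ha'
  have hw0 : ∀ k : Freq d, 0 ≤ gevreyWeight r (β / 2) k := fun k =>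
    mul_nonneg (Real.rpow_nonneg (freqNorm_nonneg k) _) (Real.exp_nonneg _)
  have hle : ∀ n, wienerNorm 0 (a' n) ≤ ENNReal.ofReal K * wienerNorm β (a n) := by
    intro n
    unfold wienerNorm
    rw [← ENNReal.tsum_mul_left]
    refine ENNReal.tsum_le_tsum fun k => ?_
    rw [ha', zero_mul, Real.exp_zero, ENNReal.ofReal_one, one_mul, enorm_mul, ← mul_assoc,
      ← ENNReal.ofReal_mul hK0]
    gcongr
    rw [← ofReal_norm, Complex.norm_real, Real.norm_of_nonneg (hw0 k)]
    exact ENNReal.ofReal_le_ofReal (hK k)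
  have h' : SeriesBound 0 s a' := by
    refine lt_of_le_of_lt (ENNReal.tsum_le_tsum fun n => mul_le_mul_right (hle n) _) ?_
    simp_rw [mul_left_comm _ (ENNReal.ofReal K)]
    rw [ENNReal.tsum_mul_left]
    exact ENNReal.mul_lt_top ENNReal.ofReal_lt_top h
  have hnhds : Metric.ball (0 : ℂ) s ∈ 𝓝 ζ₀ :=
    Metric.isOpen_ball.mem_nhds (mem_ball_zero_iff.2 hζ₀)
  refine ⟨β / 2, by positivity, timeSeries a',
    (h'.differentiableOn le_rfl hs).analyticAt hnhds, ?_⟩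
  filter_upwards [hnhds] with ζ hζ k
  have hζ' := (mem_ball_zero_iff.1 hζ).le
  refine (h'.hasSum_coeff le_rfl hs hζ' k).unique ?_
  refine ((h.hasSum_coeff hβ.le hs hζ' k).mul_left _).congr_fun fun n => ?_
  simp only [ha']
  ring

end Series

/-! ### The Taylor series solves the Boussinesq system -/

/-- The `i`-th component of the Leray projection at frequency `k`, as a linear functional. -/
def lerayL (k : Freq d) (i : Fin d) : (Fin d → ℂ) →L[ℂ] ℂ :=
  LinearMap.toContinuousLinearMap
    { toFun := fun w => leray k w i
      map_add' := fun v w => by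
        unfold leray
        split_ifs
        · simp
        · simp only [Pi.add_apply, mul_add, Finset.sum_add_distrib]
          ring
      map_smul' := fun c w => by
        unfold leray
        split_ifs
        · simp
        · simp only [Pi.smul_apply, smul_eq_mul, mul_left_comm _ c, ← Finset.mul_sum,
            RingHom.id_apply]
          ring }

lemma lerayL_apply (k : Freq d) (i : Fin d) (w : Fin d → ℂ) : lerayL k i w = leray k w i := rfl

lemma sum_mul_leray (k : Freq d) (w : Fin d → ℂ) : ∑ i, (k i : ℂ) * leray k w i = 0 := by
  unfold leray
  split_ifs with hk
  · simp
  · have hpos : 0 < freqNorm k := one_pos.trans_le (one_le_freqNorm hk)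
    have hsq : ∑ i, (k i : ℂ) * (k i : ℂ) = ((freqNorm k ^ 2 : ℝ) : ℂ) := by
      rw [freqNorm, Real.sq_sqrt (Finset.sum_nonneg fun _ _ => sq_nonneg _)]
      push_cast
      exact Finset.sum_congr rfl fun i _ => by ring
    have hne : ((freqNorm k ^ 2 : ℝ) : ℂ) ≠ 0 := by exact_mod_cast (pow_pos hpos 2).ne'
    simp only [mul_sub, Finset.sum_sub_distrib, mul_left_comm (k _ : ℂ) (_ / _), ← Finset.mul_sum]
    rw [hsq, div_mul_cancel₀ _ hne, sub_self]

lemma leray_zero (w : Fin d → ℂ) (i : Fin d) : leray 0 w i = 0 := if_pos rfl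

lemma advConv_zero (u : Fin d → Freq d → ℂ) (f : Freq d → ℂ) : advConv u f 0 = 0 := by
  simp [advConv]

lemma advectionCoeff_eq (u : Fin d → L2 d) (f : L2 d) (k : Freq d) :
    advectionCoeff u f k = ∑ j, Complex.I * (k j : ℂ) * prodCoeffL k (u j) f := by
  simp only [advectionCoeff, prodCoeffL_apply]

section Solution

variable {g : ℝ} {e : EuclideanSpace ℝ (Fin d)} {u₀ : Fin d → Freq d → ℂ} {η₀ : Freq d → ℂ}

lemma velCoeff_apply_zero (h : ∀ i, u₀ i 0 = 0) (n : ℕ) (i : Fin d) :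
    velCoeff g e u₀ η₀ n i 0 = 0 := by
  rcases n with _ | n
  · simpa using h i
  · simp [velCoeff_succ, leray_zero]

lemma scalCoeff_apply_zero (h : η₀ 0 = 0) (n : ℕ) : scalCoeff g e u₀ η₀ n 0 = 0 := by
  rcases n with _ | n
  · simpa using h
  · simp [scalCoeff_succ, advConv_zero]

/-- Every coefficient after the initial one is a combination of Leray projections. -/
lemma sum_mul_velCoeff (h : ∀ k : Freq d, ∑ i, (k i : ℂ) * u₀ i k = 0) (n : ℕ) (k : Freq d) :
    ∑ i, (k i : ℂ) * velCoeff g e u₀ η₀ n i k = 0 := by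
  rcases n with _ | n
  · simpa using h k
  · simp_rw [velCoeff_succ, ← lerayL_apply, ← map_sum, ← map_neg, ← map_add, lerayL_apply,
      mul_left_comm _ (((n : ℂ) + 1)⁻¹), ← Finset.mul_sum, sum_mul_leray, mul_zero]

lemma SeriesBound.hasSum_advectionCoeff {β s : ℝ} {v : ℕ → Fin d → Freq d → ℂ}
    {b : ℕ → Freq d → ℂ} (hv : ∀ j, SeriesBound β s fun n => v n j) (hb : SeriesBound β s b)
    (hβ : 0 ≤ β) (hs : 0 < s) {ζ : ℂ} (hζ : ‖ζ‖ ≤ s) (k : Freq d) :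
    HasSum (fun n => ζ ^ n * ∑ m ∈ Finset.range (n + 1), advConv (v m) (b (n - m)) k)
      (advectionCoeff (fun j => timeSeries (fun n => v n j) ζ) (timeSeries b ζ) k) := by
  rw [advectionCoeff_eq]
  have h := hasSum_sum (s := Finset.univ) fun j _ =>
    ((hv j).hasSum_prodCoeffL hb hβ hs hζ k).mul_left (Complex.I * (k j : ℂ))
  refine h.congr_fun fun n => ?_
  simp only [advConv]
  rw [Finset.sum_comm, Finset.mul_sum]
  refine Finset.sum_congr rfl fun j _ => ?_
  rw [← Finset.mul_sum]
  ring

/-- The weight `β` may degenerate as `s → ρ`, so each identity at `ζ` is checked on a disc of radius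
`s` between `‖ζ‖` and `ρ`. The series is also holomorphic at `0`, which yields the initial
condition. -/
lemma isSolution_timeSeries {R : Set ℂ} {ρ : ℝ} (hρ : 0 < ρ) (hR : ∀ ζ ∈ R, ‖ζ‖ < ρ)
    {u₀ : Fin d → L2 d} {η₀ : L2 d} (hu₀ : InH u₀) (hη₀ : MeanZero η₀)
    (H : ∀ s, 0 < s → s < ρ → ∃ β, 0 < β ∧
      SeriesBound β s (scalCoeff g e (fun i => coeff (u₀ i)) (coeff η₀)) ∧
      ∀ i, SeriesBound β s fun n => velCoeff g e (fun i => coeff (u₀ i)) (coeff η₀) n i) :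
    IsSolution g e u₀ η₀ R
      (fun ζ i => timeSeries (fun n => velCoeff g e (fun i => coeff (u₀ i)) (coeff η₀) n i) ζ)
      (timeSeries (scalCoeff g e (fun i => coeff (u₀ i)) (coeff η₀))) := by
  set U := velCoeff g e (fun i => coeff (u₀ i)) (coeff η₀) with hU
  set T := scalCoeff g e (fun i => coeff (u₀ i)) (coeff η₀) with hT
  have H' : ∀ ζ : ℂ, ‖ζ‖ < ρ → ∃ s β, ‖ζ‖ < s ∧ 0 < s ∧ 0 ≤ β ∧ SeriesBound β s T ∧
      ∀ i, SeriesBound β s fun n => U n i := by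
    intro ζ hζ
    obtain ⟨s, hs1, hs2⟩ := exists_between hζ
    have hs : 0 < s := (norm_nonneg ζ).trans_lt hs1
    obtain ⟨β, hβ, h1, h2⟩ := H s hs hs2
    exact ⟨s, β, hs1, hs, hβ.le, h1, h2⟩
  have hdiff_T : ∀ ζ : ℂ, ‖ζ‖ < ρ → DifferentiableAt ℂ (timeSeries T) ζ := by
    intro ζ hζ
    obtain ⟨s, β, hs1, hs, hβ, hT', -⟩ := H' ζ hζ
    exact (hT'.differentiableOn hβ hs).differentiableAt
      (Metric.isOpen_ball.mem_nhds (mem_ball_zero_iff.2 hs1))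
  have hdiff_U : ∀ ζ : ℂ, ‖ζ‖ < ρ → ∀ i,
      DifferentiableAt ℂ (timeSeries fun n => U n i) ζ := by
    intro ζ hζ i
    obtain ⟨s, β, hs1, hs, hβ, -, hU'⟩ := H' ζ hζ
    exact ((hU' i).differentiableOn hβ hs).differentiableAt
      (Metric.isOpen_ball.mem_nhds (mem_ball_zero_iff.2 hs1))
  have hdiff_pi : ∀ ζ : ℂ, ‖ζ‖ < ρ →
      DifferentiableAt ℂ (fun ζ i => timeSeries (fun n => U n i) ζ) ζ := fun ζ hζ =>
    differentiableAt_pi.2 (hdiff_U ζ hζ)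
  have hzero : ‖(0 : ℂ)‖ < ρ := by simpa using hρ
  have hU0 : (fun i => timeSeries (fun n => U n i) 0) = u₀ := by
    obtain ⟨s, β, -, hs, hβ, -, hU'⟩ := H' 0 hzero
    funext i
    refine eq_of_coeff_eq fun k => ?_
    rw [timeSeries_zero, coeff_ofCoeff ((hU' i).summable_norm_coeff hβ hs 0), hU, velCoeff_zero]
  have hT0 : timeSeries T 0 = η₀ := by
    obtain ⟨s, β, -, hs, hβ, hT', -⟩ := H' 0 hzero
    refine eq_of_coeff_eq fun k => ?_
    rw [timeSeries_zero, coeff_ofCoeff (hT'.summable_norm_coeff hβ hs 0), hT, scalCoeff_zero]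
  refine ⟨fun ζ hζ => ⟨fun i => ?_, fun k => ?_⟩, fun ζ hζ => ?_,
    fun ζ hζ => (hdiff_pi ζ (hR ζ hζ)).differentiableWithinAt,
    fun ζ hζ => (hdiff_T ζ (hR ζ hζ)).differentiableWithinAt, fun ζ hζ k i => ?_,
    fun ζ hζ k => ?_, ?_, ?_⟩
  · obtain ⟨s, β, hs1, hs, hβ, -, hU'⟩ := H' ζ (hR ζ hζ)
    refine ((hU' i).hasSum_coeff hβ hs hs1.le 0).unique ?_
    simp only [hU, velCoeff_apply_zero hu₀.1, mul_zero, hasSum_zero]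
  · obtain ⟨s, β, hs1, hs, hβ, -, hU'⟩ := H' ζ (hR ζ hζ)
    refine (hasSum_sum (s := Finset.univ) fun i _ =>
      ((hU' i).hasSum_coeff hβ hs hs1.le k).mul_left (k i : ℂ)).unique ?_
    simp only [mul_left_comm (k _ : ℂ), ← Finset.mul_sum, hU, sum_mul_velCoeff hu₀.2, mul_zero,
      hasSum_zero]
  · obtain ⟨s, β, hs1, hs, hβ, hT', -⟩ := H' ζ (hR ζ hζ)
    refine (hT'.hasSum_coeff hβ hs hs1.le 0).unique ?_
    simp only [hT, scalCoeff_apply_zero hη₀, mul_zero, hasSum_zero]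
  · obtain ⟨s, β, hs1, hs, hβ, hT', hU'⟩ := H' ζ (hR ζ hζ)
    rw [deriv_pi fun i => hdiff_U ζ (hR ζ hζ) i]
    have hder := (hU' i).hasSum_coeff_deriv hβ hs hs1 k
    have hadv := (lerayL k i).hasSum (Pi.hasSum.2 fun l =>
      SeriesBound.hasSum_advectionCoeff hU' (hU' l) hβ hs hs1.le k)
    have hlin := (lerayL k i).hasSum (Pi.hasSum.2 fun l =>
      ((hT'.hasSum_coeff hβ hs hs1.le k).mul_left (g : ℂ)).mul_right (e l : ℂ))
    -- Both sides are power series in `ζ`; equality of the `n`-th terms is the recursion multiplied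
    -- by `n + 1`.
    refine (hder.add hadv).unique (hlin.congr_fun fun n => ?_)
    have hn : (n : ℂ) + 1 ≠ 0 := by exact_mod_cast Nat.succ_ne_zero n
    have e1 : (fun l => ζ ^ n * ∑ m ∈ Finset.range (n + 1), advConv (U m) (U (n - m) l) k) =
        ζ ^ n • ∑ m ∈ Finset.range (n + 1), fun l => advConv (U m) (U (n - m) l) k := by
      funext l
      simp
    have e2 : (fun l => (g : ℂ) * (ζ ^ n * T n k) * (e l : ℂ)) =
        ζ ^ n • fun l => (g : ℂ) * T n k * (e l : ℂ) := by
      funext l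
      simp only [Pi.smul_apply, smul_eq_mul]
      ring
    rw [e1, e2, map_smul, map_smul, map_sum, hU, velCoeff_succ, mul_inv_cancel_left₀ hn]
    simp only [lerayL_apply, smul_eq_mul, hT]
    ring
  · obtain ⟨s, β, hs1, hs, hβ, hT', hU'⟩ := H' ζ (hR ζ hζ)
    refine ((hT'.hasSum_coeff_deriv hβ hs hs1 k).add
      (SeriesBound.hasSum_advectionCoeff hU' hT' hβ hs hs1.le k)).unique ?_
    convert hasSum_zero using 1
    funext n
    have hn : (n : ℂ) + 1 ≠ 0 := by exact_mod_cast Nat.succ_ne_zero n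
    rw [hT, scalCoeff_succ, mul_inv_cancel_left₀ hn]
    ring
  · have := (hdiff_pi 0 hzero).continuousAt.tendsto
    rw [hU0] at this
    exact this.mono_left nhdsWithin_le_nhds
  · have := (hdiff_T 0 hzero).continuousAt.tendsto
    rw [hT0] at this
    exact this.mono_left nhdsWithin_le_nhds

end Solution

/-! ### Uniqueness -/

/-- Two solutions of a quadratic differential equation, stated weakly through a separating family
of functionals and away from the initial time only, agree near the initial time as soon as they are
analytic and have the same initial value. -/
lemma eventuallyEq_of_weak_quadratic_ode {E ι : Type*} [NormedAddCommGroup E] [NormedSpace ℂ E]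
    [CompleteSpace E] {Φ : ι → E →L[ℂ] ℂ} (hΦ : ∀ x, (∀ k, Φ k x = 0) → x = 0) {B : ι → E →L[ℂ] E →L[ℂ] ℂ}
    {Λ : ι → E →L[ℂ] ℂ} {f₁ f₂ : ℂ → E} (h₁ : AnalyticAt ℂ f₁ 0) (h₂ : AnalyticAt ℂ f₂ 0)
    (h0 : f₁ 0 = f₂ 0)
    (hode₁ : ∀ᶠ ζ in 𝓝[≠] (0 : ℂ), ∀ k,
      Φ k (deriv f₁ ζ) = B k (f₁ ζ) (f₁ ζ) + Λ k (f₁ ζ))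
    (hode₂ : ∀ᶠ ζ in 𝓝[≠] (0 : ℂ), ∀ k,
      Φ k (deriv f₂ ζ) = B k (f₂ ζ) (f₂ ζ) + Λ k (f₂ ζ)) :
    f₁ =ᶠ[𝓝 0] f₂ := by
  have hw : AnalyticAt ℂ (fun ζ => f₁ ζ - f₂ ζ) 0 := h₁.sub h₂
  by_contra hne
  have hne' : ¬∀ᶠ ζ in 𝓝 (0 : ℂ), f₁ ζ - f₂ ζ = 0 := fun h =>
    hne (h.mono fun ζ hζ => sub_eq_zero.1 hζ)
  -- Factor out the exact order of vanishing at `0`; equal initial values exclude order `0`.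
  obtain ⟨n, h, hh, hh0, heq⟩ := hw.exists_eventuallyEq_pow_smul_nonzero_iff.2 hne'
  simp only [sub_zero] at heq
  rcases n with _ | m
  · have := heq.self_of_nhds
    simp only [pow_zero, one_smul, h0, sub_self] at this
    exact hh0 this.symm
  refine hh0 (hΦ _ fun k => ?_)
  -- The equation for the difference, divided by `ζ ^ m`: only the derivative of `ζ ^ (m + 1)` lacks
  -- a further factor `ζ`.
  have hev : ∀ᶠ ζ in 𝓝[≠] (0 : ℂ), ((m : ℂ) + 1) * Φ k (h ζ) =
      ζ * (B k (f₁ ζ) (h ζ) + B k (h ζ) (f₂ ζ) + Λ k (h ζ) - Φ k (deriv h ζ)) := by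
    filter_upwards [hode₁, hode₂, eventually_nhdsWithin_of_eventually_nhds
      (eventually_eventually_nhds.2 heq), eventually_nhdsWithin_of_eventually_nhds
      h₁.eventually_analyticAt, eventually_nhdsWithin_of_eventually_nhds h₂.eventually_analyticAt,
      eventually_nhdsWithin_of_eventually_nhds hh.eventually_analyticAt,
      self_mem_nhdsWithin] with ζ e₁ e₂ hζ a₁ a₂ ah hζ0
    have hζ0' : ζ ≠ 0 := hζ0
    have hval := hζ.self_of_nhds
    have hder : deriv f₁ ζ - deriv f₂ ζ =
        ζ ^ (m + 1) • deriv h ζ + (((m : ℂ) + 1) * ζ ^ m) • h ζ := by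
      have h3 : HasDerivAt (fun ζ => f₁ ζ - f₂ ζ) (deriv f₁ ζ - deriv f₂ ζ) ζ :=
        a₁.differentiableAt.hasDerivAt.sub a₂.differentiableAt.hasDerivAt
      have h4 := (hasDerivAt_pow (m + 1) ζ).smul ah.differentiableAt.hasDerivAt
      have h5 := (h4.congr_of_eventuallyEq (f₁ := fun ζ => f₁ ζ - f₂ ζ) hζ).unique h3
      rw [← h5]
      push_cast
      simp
    have hΦw := congr_arg (Φ k) hder
    rw [map_sub, e₁ k, e₂ k, map_add, map_smul, map_smul, smul_eq_mul, smul_eq_mul] at hΦw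
    have hB : B k (f₁ ζ) (f₁ ζ) - B k (f₂ ζ) (f₂ ζ) =
        ζ ^ (m + 1) * (B k (f₁ ζ) (h ζ) + B k (h ζ) (f₂ ζ)) := by
      have h6 : B k (f₁ ζ) (f₁ ζ) - B k (f₂ ζ) (f₂ ζ) =
          B k (f₁ ζ) (f₁ ζ - f₂ ζ) + B k (f₁ ζ - f₂ ζ) (f₂ ζ) := by
        simp only [map_sub, _root_.sub_apply]
        ring
      rw [h6, hval]
      simp only [map_smul, _root_.smul_apply, smul_eq_mul]
      ring
    have hΛ : Λ k (f₁ ζ) - Λ k (f₂ ζ) = ζ ^ (m + 1) * Λ k (h ζ) := by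
      rw [← map_sub, hval, map_smul, smul_eq_mul]
    refine mul_left_cancel₀ (pow_ne_zero m hζ0') ?_
    rw [pow_succ] at *
    linear_combination hB + hΛ - hΦw
  have hcont : ContinuousAt (fun ζ => ζ * (B k (f₁ ζ) (h ζ) + B k (h ζ) (f₂ ζ) + Λ k (h ζ) -
      Φ k (deriv h ζ))) 0 := by
    have c₁ := h₁.continuousAt
    have c₂ := h₂.continuousAt
    have ch := hh.continuousAt
    have cd := hh.deriv.continuousAt
    fun_prop
  have hleft : ContinuousAt (fun ζ => ((m : ℂ) + 1) * Φ k (h ζ)) 0 := by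
    have ch := hh.continuousAt
    fun_prop
  -- As `ζ → 0` through nonzero values the right side vanishes, leaving `(m + 1) Φ k (h 0) = 0`.
  have hlim := tendsto_nhds_unique
    ((hcont.tendsto.mono_left nhdsWithin_le_nhds).congr' (hev.mono fun _ h => h.symm))
    (hleft.tendsto.mono_left nhdsWithin_le_nhds)
  simp only [zero_mul] at hlim
  exact (mul_eq_zero.1 hlim.symm).resolve_left (by exact_mod_cast Nat.succ_ne_zero m)

/-- The phase space of pairs of a vector field and a scalar. -/
abbrev Phase (d : ℕ) : Type := (Fin d → L2 d) × L2 d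

/-- The `i`-th velocity component, as a map on the phase space. -/
def velL (i : Fin d) : Phase d →L[ℂ] L2 d :=
  ContinuousLinearMap.proj i ∘L ContinuousLinearMap.fst ℂ (Fin d → L2 d) (L2 d)

/-- The scalar component, as a map on the phase space. -/
def scalL : Phase d →L[ℂ] L2 d := ContinuousLinearMap.snd ℂ (Fin d → L2 d) (L2 d)

/-- The bilinear form sending `(x, y)` to the `k`-th Fourier coefficient of `∇ · (f u)`, where `u`
is the velocity of `x` and `f = p y`. -/
def advectionL (k : Freq d) (p : Phase d →L[ℂ] L2 d) : Phase d →L[ℂ] Phase d →L[ℂ] ℂ :=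
  ∑ j, (Complex.I * (k j : ℂ)) • (prodCoeffL k).bilinearComp (velL j) p

lemma advectionL_apply (k : Freq d) (p : Phase d →L[ℂ] L2 d) (x y : Phase d) :
    advectionL k p x y = advectionCoeff x.1 (p y) k := by
  rw [advectionCoeff_eq]
  simp [advectionL, velL]

/-- The functionals that test the equations: Fourier coefficients of the velocity components and of
the scalar. -/
def testL : Freq d × Option (Fin d) → Phase d →L[ℂ] ℂ
  | (k, some i) => coeffL k ∘L velL i
  | (k, none) => coeffL k ∘L scalL

/-- The quadratic part of the Boussinesq system. -/
def quadL : Freq d × Option (Fin d) → Phase d →L[ℂ] Phase d →L[ℂ] ℂ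
  | (k, some i) => -∑ l, lerayL k i (Pi.single l 1) • advectionL k (velL l)
  | (k, none) => -advectionL k scalL

/-- The linear part of the Boussinesq system. -/
def linL (g : ℝ) (e : EuclideanSpace ℝ (Fin d)) : Freq d × Option (Fin d) → Phase d →L[ℂ] ℂ
  | (k, some i) => (leray k (fun l => (g : ℂ) * (e l : ℂ)) i) • (coeffL k ∘L scalL)
  | (_, none) => 0

/-- The matrix form of the projection identifies the projected advection with a finite sum of
bounded bilinear forms, as in `quadL`. -/
lemma leray_eq_sum (k : Freq d) (i : Fin d) (w : Fin d → ℂ) :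
    leray k w i = ∑ l, lerayL k i (Pi.single l 1) * w l := by
  have hw : w = ∑ l, w l • (Pi.single l 1 : Fin d → ℂ) := pi_eq_sum_univ' w
  conv_lhs => rw [← lerayL_apply, hw, map_sum]
  simp only [map_smul, smul_eq_mul, mul_comm]

lemma eq_zero_of_testL_eq_zero (x : Phase d) (h : ∀ k, testL k x = 0) : x = 0 :=
  Prod.ext (funext fun i => eq_zero_of_coeffL_eq_zero _ fun k => h (k, some i))
    (eq_zero_of_coeffL_eq_zero _ fun k => h (k, none))

section

variable {g : ℝ} {e : EuclideanSpace ℝ (Fin d)} {u₀ : Fin d → L2 d} {η₀ : L2 d} {ρ : ℝ}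
  {v : ℂ → Fin d → L2 d} {θ : ℂ → L2 d}

lemma mem_punctured_ball_nhds {ζ : ℂ} (hζ : ζ ∈ {ζ : ℂ | 0 < ‖ζ‖ ∧ ‖ζ‖ < ρ}) :
    {ζ : ℂ | 0 < ‖ζ‖ ∧ ‖ζ‖ < ρ} ∈ 𝓝 ζ :=
  ((isOpen_lt continuous_const continuous_norm).inter
    (isOpen_lt continuous_norm continuous_const)).mem_nhds hζ

lemma punctured_ball_mem_nhdsNE (hρ : 0 < ρ) :
    {ζ : ℂ | 0 < ‖ζ‖ ∧ ‖ζ‖ < ρ} ∈ 𝓝[≠] (0 : ℂ) := by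
  filter_upwards [self_mem_nhdsWithin,
    nhdsWithin_le_nhds (Metric.ball_mem_nhds (0 : ℂ) hρ)] with ζ h1 h2
  exact ⟨norm_pos_iff.2 h1, mem_ball_zero_iff.1 h2⟩

/-- A solution on a punctured disc, extended to the initial time by the initial data. -/
def extension (u₀ : Fin d → L2 d) (η₀ : L2 d) (v : ℂ → Fin d → L2 d) (θ : ℂ → L2 d) :
    ℂ → Phase d :=
  Function.update (fun ζ => (v ζ, θ ζ)) 0 (u₀, η₀)

lemma extension_zero : extension u₀ η₀ v θ 0 = (u₀, η₀) := Function.update_self _ _ _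

lemma extension_of_ne {ζ : ℂ} (hζ : ζ ≠ 0) : extension u₀ η₀ v θ ζ = (v ζ, θ ζ) :=
  Function.update_of_ne hζ _ _

lemma extension_eventuallyEq {ζ : ℂ} (hζ : ζ ≠ 0) :
    extension u₀ η₀ v θ =ᶠ[𝓝 ζ] fun ζ => (v ζ, θ ζ) := by
  filter_upwards [isOpen_ne.mem_nhds hζ] with z hz using extension_of_ne hz

variable (h : IsSolution g e u₀ η₀ {ζ : ℂ | 0 < ‖ζ‖ ∧ ‖ζ‖ < ρ} v θ)
include h

lemma IsSolution.hasDerivAt_extension {ζ : ℂ} (hζ : 0 < ‖ζ‖ ∧ ‖ζ‖ < ρ) :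
    HasDerivAt (extension u₀ η₀ v θ) (deriv v ζ, deriv θ ζ) ζ :=
  ((h.velocity_holo.differentiableAt (mem_punctured_ball_nhds hζ)).hasDerivAt.prodMk
    (h.scalar_holo.differentiableAt (mem_punctured_ball_nhds hζ)).hasDerivAt).congr_of_eventuallyEq
    (extension_eventuallyEq (norm_pos_iff.1 hζ.1))

/-- Convergence to the initial data makes the extension continuous at `0`, so the singularity there
is removable. -/
lemma IsSolution.analyticOnNhd_extension :
    AnalyticOnNhd ℂ (extension u₀ η₀ v θ) (Metric.ball 0 ρ) := by
  intro ζ hζ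
  have hζ' := mem_ball_zero_iff.1 hζ
  rcases eq_or_ne ζ 0 with rfl | hne
  · have hmem := punctured_ball_mem_nhdsNE ((norm_nonneg (0 : ℂ)).trans_lt hζ')
    refine Complex.analyticAt_of_differentiable_on_punctured_nhds_of_continuousAt ?_ ?_
    · filter_upwards [hmem] with z hz using (h.hasDerivAt_extension hz).differentiableAt
    · refine continuousAt_update_same.2 ?_
      refine Tendsto.mono_left ?_ (nhdsWithin_le_of_mem hmem)
      rw [nhds_prod_eq]
      exact h.velocity_init.prodMk h.scalar_init
  · refine DifferentiableOn.analyticAt (s := {ζ : ℂ | 0 < ‖ζ‖ ∧ ‖ζ‖ < ρ}) (fun z hz =>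
      (h.hasDerivAt_extension hz).differentiableAt.differentiableWithinAt)
      (mem_punctured_ball_nhds ⟨norm_pos_iff.2 hne, hζ'⟩)

lemma IsSolution.weak_ode {ζ : ℂ} (hζ : 0 < ‖ζ‖ ∧ ‖ζ‖ < ρ) (k : Freq d × Option (Fin d)) :
    testL k (deriv (extension u₀ η₀ v θ) ζ) =
      quadL k (extension u₀ η₀ v θ ζ) (extension u₀ η₀ v θ ζ) +
        linL g e k (extension u₀ η₀ v θ ζ) := by
  rw [(h.hasDerivAt_extension hζ).deriv, extension_of_ne (norm_pos_iff.1 hζ.1)]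
  obtain ⟨k, _ | i⟩ := k
  · have h1 := h.transport ζ hζ k
    simp only [testL, quadL, linL, _root_.neg_apply, advectionL_apply, _root_.zero_apply,
      ContinuousLinearMap.comp_apply, scalL, ContinuousLinearMap.coe_snd', coeffL_apply]
    linear_combination h1
  · have h1 := h.momentum ζ hζ k i
    have h2 : leray k (fun l => (g : ℂ) * coeff (θ ζ) k * (e l : ℂ)) i =
        leray k (fun l => (g : ℂ) * (e l : ℂ)) i * coeff (θ ζ) k := by
      have : (fun l => (g : ℂ) * coeff (θ ζ) k * (e l : ℂ)) =
          coeff (θ ζ) k • fun l => (g : ℂ) * (e l : ℂ) := by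
        funext l
        simp only [Pi.smul_apply, smul_eq_mul]
        ring
      rw [this, ← lerayL_apply, map_smul, lerayL_apply, smul_eq_mul, mul_comm]
    rw [h2, leray_eq_sum k i fun l => advectionCoeff (v ζ) (v ζ l) k] at h1
    simp only [testL, quadL, linL, _root_.neg_apply, advectionL_apply, _root_.smul_apply,
      _root_.sum_apply, smul_eq_mul, ContinuousLinearMap.comp_apply, scalL, velL,
      ContinuousLinearMap.coe_snd', ContinuousLinearMap.coe_fst', ContinuousLinearMap.proj_apply,
      coeffL_apply]
    linear_combination h1

/-- Solutions on a punctured disc are unique. -/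
lemma IsSolution.unique {u : ℂ → Fin d → L2 d} {η : ℂ → L2 d} (hρ : 0 < ρ)
    (h' : IsSolution g e u₀ η₀ {ζ : ℂ | 0 < ‖ζ‖ ∧ ‖ζ‖ < ρ} u η) {ζ : ℂ}
    (hζ : 0 < ‖ζ‖ ∧ ‖ζ‖ < ρ) : v ζ = u ζ ∧ θ ζ = η ζ := by
  have h0 : (0 : ℂ) ∈ Metric.ball (0 : ℂ) ρ := Metric.mem_ball_self hρ
  have hmem := punctured_ball_mem_nhdsNE hρ
  have hev := eventuallyEq_of_weak_quadratic_ode eq_zero_of_testL_eq_zero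
    (h.analyticOnNhd_extension 0 h0) (h'.analyticOnNhd_extension 0 h0)
    (by rw [extension_zero, extension_zero])
    (mem_of_superset hmem fun z hz k => h.weak_ode hz k)
    (mem_of_superset hmem fun z hz k => h'.weak_ode hz k)
  have heq := h.analyticOnNhd_extension.eqOn_of_preconnected_of_eventuallyEq
    h'.analyticOnNhd_extension (convex_ball 0 ρ).isPreconnected h0 hev
    (mem_ball_zero_iff.2 hζ.2)
  rw [extension_of_ne (norm_pos_iff.1 hζ.1), extension_of_ne (norm_pos_iff.1 hζ.1)] at heq
  exact Prod.ext_iff.1 heq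

end

/-! ### Control of the Wiener norm by the Gevrey norm -/

/-- The frequencies form a lattice of rank `d` in Euclidean space, and the exponent `d + 1` exceeds
the rank. -/
lemma summable_freqNorm_rpow (d : ℕ) :
    Summable fun k : Freq d => freqNorm k ^ (-((d : ℝ) + 1)) := by
  set b := (EuclideanSpace.basisFun (Fin d) ℝ).toBasis with hb
  set L := Submodule.span ℤ (Set.range b) with hL
  have hrank : Module.finrank ℤ L = d := by
    rw [ZLattice.rank ℝ L, finrank_euclideanSpace, Fintype.card_fin]
  have hsum : Summable fun z : L => ‖z‖ ^ (-((d : ℝ) + 1)) :=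
    ZLattice.summable_norm_rpow L _ (by rw [hrank]; linarith)
  have hmem : ∀ k : Freq d,
      (WithLp.toLp 2 (fun i => (k i : ℝ)) : EuclideanSpace ℝ (Fin d)) ∈ L := by
    intro k
    rw [hL, Module.Basis.mem_span_iff_repr_mem]
    intro i
    exact ⟨k i, by simp [hb]⟩
  have hinj : Function.Injective fun k : Freq d => (⟨_, hmem k⟩ : L) := by
    intro k l hkl
    have h := congr_arg (fun z : L => (z : EuclideanSpace ℝ (Fin d))) hkl
    funext i
    have hi : (k i : ℝ) = l i := congr_arg (fun z : EuclideanSpace ℝ (Fin d) => z i) h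
    exact_mod_cast hi
  refine (hsum.comp_injective hinj).congr fun k => ?_
  rw [Function.comp_apply, freqNorm_eq_norm, Submodule.coe_norm]

/-- The Cauchy–Schwarz inequality for sums in `[0, ∞]`. -/
lemma ennreal_tsum_mul_le_sqrt {ι : Type*} (f g : ι → ℝ≥0∞) :
    ∑' i, f i * g i ≤ (∑' i, f i ^ 2) ^ (1 / 2 : ℝ) * (∑' i, g i ^ 2) ^ (1 / 2 : ℝ) := by
  let _ : MeasurableSpace ι := ⊤
  have h := ENNReal.lintegral_mul_le_Lp_mul_Lq (Measure.count : Measure ι)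
    Real.HolderConjugate.two_two (f := f) (g := g) measurable_from_top.aemeasurable
    measurable_from_top.aemeasurable
  simpa only [lintegral_count, Pi.mul_apply, ENNReal.rpow_two] using h

/-- The square root of the sum `∑ |k| ^ (-(d + 1))` over the nonzero frequencies. -/
def latticeConst (d : ℕ) : ℝ := (∑' k : Freq d, freqNorm k ^ (-((d : ℝ) + 1))) ^ (1 / 2 : ℝ)

lemma latticeConst_nonneg (d : ℕ) : 0 ≤ latticeConst d :=
  Real.rpow_nonneg (tsum_nonneg fun k => Real.rpow_nonneg (freqNorm_nonneg k) _) _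

/-- Cauchy–Schwarz after splitting off `|k| ^ (-r)`. Since `|k| ≥ 1` off zero and `2r > d + 1`, the
sum of `|k| ^ (-2r)` is dominated by one independent of `r`. -/
lemma wienerNorm_coeff_le {r β : ℝ} (hr : ((d : ℝ) + 1) / 2 < r) {f : L2 d} (hf : MeanZero f) :
    wienerNorm β (coeff f) ≤ ENNReal.ofReal (latticeConst d) * gevreySq r β f ^ (1 / 2 : ℝ) := by
  have hr0 : 0 < r := lt_trans (by positivity) hr
  have hw0 : ∀ k : Freq d, 0 ≤ gevreyWeight r β k := fun k =>
    mul_nonneg (Real.rpow_nonneg (freqNorm_nonneg k) _) (Real.exp_nonneg _)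
  have hterm : ∀ k : Freq d, ENNReal.ofReal (Real.exp (β * freqNorm k)) * ‖coeff f k‖ₑ ≤
      ENNReal.ofReal (freqNorm k ^ (-r)) * ENNReal.ofReal (gevreyWeight r β k * ‖coeff f k‖) := by
    intro k
    rcases eq_or_ne k 0 with rfl | hk
    · rw [show coeff f 0 = 0 from hf]
      simp
    · have hpos : 0 < freqNorm k := one_pos.trans_le (one_le_freqNorm hk)
      rw [← ofReal_norm, ← ENNReal.ofReal_mul (Real.exp_nonneg _),
        ← ENNReal.ofReal_mul (Real.rpow_nonneg hpos.le _)]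
      refine ENNReal.ofReal_le_ofReal (le_of_eq ?_)
      rw [gevreyWeight, Real.rpow_neg hpos.le]
      have := (Real.rpow_pos_of_pos hpos r).ne'
      field_simp
  refine (ENNReal.tsum_le_tsum hterm).trans ((ennreal_tsum_mul_le_sqrt _ _).trans ?_)
  gcongr
  · rw [latticeConst, ← ENNReal.ofReal_rpow_of_nonneg
      (tsum_nonneg fun k => Real.rpow_nonneg (freqNorm_nonneg k) _) (by norm_num),
      ENNReal.ofReal_tsum_of_nonneg (fun k => Real.rpow_nonneg (freqNorm_nonneg k) _)
        (summable_freqNorm_rpow d)]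
    gcongr with k
    rw [← ENNReal.ofReal_pow (Real.rpow_nonneg (freqNorm_nonneg k) _)]
    refine ENNReal.ofReal_le_ofReal ?_
    -- At `k = 0` both real powers are `0`, since `0 ^ x = 0` for `x ≠ 0`.
    rcases eq_or_ne k 0 with rfl | hk
    · rw [freqNorm_zero, Real.zero_rpow (by linarith), Real.zero_rpow (by
        have : (0 : ℝ) ≤ d := Nat.cast_nonneg d
        linarith)]
      simp
    · rw [← Real.rpow_natCast, ← Real.rpow_mul (freqNorm_nonneg k)]
      exact Real.rpow_le_rpow_of_exponent_le (one_le_freqNorm hk) (by push_cast; linarith)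
  · unfold gevreySq
    simp_rw [← ENNReal.ofReal_pow (mul_nonneg (hw0 _) (norm_nonneg (coeff f _)))]
    -- The normalising factor `(2π) ^ d` is at least `1` and is simply dropped.
    refine le_mul_of_one_le_left zero_le ?_
    rw [ENNReal.one_le_ofReal]
    exact one_le_pow₀ (by linarith [Real.pi_gt_three])

lemma gevreySq_le_gevreyNorm_velocity (r β : ℝ) (u : Fin d → L2 d) (η : L2 d) (i : Fin d) :
    gevreySq r β (u i) ^ (1 / 2 : ℝ) ≤ gevreyNorm r β u η := by
  unfold gevreyNorm
  gcongr
  exact (Finset.single_le_sum (f := fun i => gevreySq r β (u i)) (fun _ _ => zero_le)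
    (Finset.mem_univ i)).trans le_self_add

lemma gevreySq_le_gevreyNorm_scalar (r β : ℝ) (u : Fin d → L2 d) (η : L2 d) :
    gevreySq r β η ^ (1 / 2 : ℝ) ≤ gevreyNorm r β u η := by
  unfold gevreyNorm
  gcongr
  exact le_add_self

/-! ### The region of holomorphy -/

/-- Both `2 ^ r` and the fraction in `wienerConst` are at least `1`. This removes `r` from the bound
on the radius and lets `C` depend only on `d`. -/
lemma le_two_rpow_mul_wienerConst {r : ℝ} (hr : ((d : ℝ) + 1) / 2 < r) :
    1 / (Real.pi * 2 ^ ((d : ℝ) - 1)) ≤ 2 ^ r * wienerConst d r := by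
  have hd : (0 : ℝ) ≤ d := Nat.cast_nonneg d
  have hκ : 0 < 1 / (Real.pi * (2 : ℝ) ^ ((d : ℝ) - 1)) := by positivity
  have h1 : 1 ≤ (2 * r - d) / (2 * r - 1 - d) := by
    rw [one_le_div (by linarith)]
    linarith
  have h2 : (1 : ℝ) ≤ 2 ^ r := Real.one_le_rpow (by norm_num) (by linarith)
  unfold wienerConst
  exact (le_mul_of_one_le_right hκ.le h1).trans
    (le_mul_of_one_le_left (mul_nonneg hκ.le (by linarith)) h2)

/-- The region is a punctured disc, whose radius is bounded in terms of the data. -/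
lemma exists_region_eq {C r g β₀ : ℝ} {N : ℝ≥0∞} (hC : 0 < C) (hr : ((d : ℝ) + 1) / 2 < r)
    (hg : 0 < g) (hβ₀ : 0 < β₀) (hN : N < ∞) :
    ∃ ρ, 0 < ρ ∧ region d C r g β₀ N = {ζ : ℂ | 0 < ‖ζ‖ ∧ ‖ζ‖ < ρ} ∧ g * ρ ≤ 2 ∧
      ρ * N.toReal ≤ Real.pi * 2 ^ ((d : ℝ) - 1) * C * β₀ := by
  set κ : ℝ := Real.pi * 2 ^ ((d : ℝ) - 1) with hκ_def
  have hκ : 0 < κ := by positivity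
  have hW := le_two_rpow_mul_wienerConst hr
  rw [← hκ_def] at hW
  set w : ℝ := 2 ^ r * wienerConst d r with hw_def
  have hw : 0 < w := lt_of_lt_of_le (by positivity) hW
  set m : ℝ≥0∞ := min (ENNReal.ofReal (C * β₀) / (ENNReal.ofReal w * N))
    (ENNReal.ofReal (2 * Real.log 2 / g)) with hm
  have hlog := Real.log_pos one_lt_two
  -- The entry with `g` keeps the radius finite even when `N = 0`.
  have hm_top : m ≠ ∞ := ne_top_of_le_ne_top ENNReal.ofReal_ne_top (min_le_right _ _)
  have hm_pos : 0 < m := by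
    refine lt_min (ENNReal.div_pos ?_ ?_) (by simpa using by positivity)
    · simpa using by positivity
    · exact ENNReal.mul_ne_top ENNReal.ofReal_ne_top hN.ne
  have hρ_le : ENNReal.ofReal m.toReal = m := ENNReal.ofReal_toReal hm_top
  refine ⟨m.toReal, ENNReal.toReal_pos hm_pos.ne' hm_top, ?_, ?_, ?_⟩
  · ext ζ
    simp only [region, Set.mem_ofPred_eq, ← hw_def, ← hm]
    rw [ENNReal.ofReal_lt_iff_lt_toReal (norm_nonneg ζ) hm_top]
  · have h1 : m.toReal ≤ 2 * Real.log 2 / g :=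
      ENNReal.toReal_le_of_le_ofReal (by positivity) (min_le_right _ _)
    rw [le_div_iff₀ hg] at h1
    linarith [Real.log_two_lt_d9]
  · have h1 : m * (ENNReal.ofReal w * N) ≤ ENNReal.ofReal (C * β₀) :=
      ENNReal.mul_le_of_le_div (min_le_left _ _)
    have h2 := ENNReal.toReal_le_of_le_ofReal (by positivity) h1
    rw [ENNReal.toReal_mul, ENNReal.toReal_mul, ENNReal.toReal_ofReal hw.le] at h2
    have h3 : 0 ≤ m.toReal * N.toReal := by positivity
    have h4 : 1 ≤ κ * w := by
      rw [div_le_iff₀ hκ] at hW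
      linarith
    calc m.toReal * N.toReal ≤ (m.toReal * N.toReal) * (κ * w) := le_mul_of_one_le_right h3 h4
      _ = κ * (m.toReal * (w * N.toReal)) := by ring
      _ ≤ κ * (C * β₀) := by gcongr
      _ = _ := by ring

end Boussinesq

end

/-! ### Choice of constants and conclusion -/

theorem theorem5p1 (d : ℕ) (hd : d = 2 ∨ d = 3) :
    ∃ C : ℝ, 0 < C ∧
      ∀ (r : ℝ), ((d : ℝ) + 1) / 2 < r →
      ∀ (g : ℝ), 0 < g →
      ∀ (e : EuclideanSpace ℝ (Fin d)), ‖e‖ = 1 →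
      ∀ (β₀ : ℝ), 0 < β₀ →
      ∀ (u₀ : Fin d → Boussinesq.L2 d) (η₀ : Boussinesq.L2 d),
        Boussinesq.InH u₀ → Boussinesq.MeanZero η₀ →
        Boussinesq.gevreyNorm r β₀ u₀ η₀ < ∞ →
        ∃ (u : ℂ → Fin d → Boussinesq.L2 d) (η : ℂ → Boussinesq.L2 d),
          Boussinesq.IsSolution g e u₀ η₀
            (Boussinesq.region d C r g β₀ (Boussinesq.gevreyNorm r β₀ u₀ η₀)) u η ∧
          (∀ ζ ∈ Boussinesq.region d C r g β₀ (Boussinesq.gevreyNorm r β₀ u₀ η₀),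
            (∀ i, Boussinesq.GevreyHolomorphicAt r (fun z => u z i) ζ) ∧
              Boussinesq.GevreyHolomorphicAt r η ζ) ∧
          ∀ (v : ℂ → Fin d → Boussinesq.L2 d) (θ : ℂ → Boussinesq.L2 d),
            Boussinesq.IsSolution g e u₀ η₀
              (Boussinesq.region d C r g β₀ (Boussinesq.gevreyNorm r β₀ u₀ η₀)) v θ →
            ∀ ζ ∈ Boussinesq.region d C r g β₀ (Boussinesq.gevreyNorm r β₀ u₀ η₀),
              v ζ = u ζ ∧ θ ζ = η ζ := by
  -- The factor `16` is `8 · 2`: the `8` of the buoyancy condition times the bound `g ρ ≤ 2`. Also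
  -- `A ≥ d`, which covers the sum over initial velocity components.
  set A : ℝ := 16 * ((1 + d) * d) with hA_def
  set κ : ℝ := Real.pi * 2 ^ ((d : ℝ) - 1) with hκ_def
  set K : ℝ := Boussinesq.latticeConst d with hK_def
  have hA : 0 ≤ A := by positivity
  have hκ : 0 < κ := by positivity
  have hK : 0 ≤ K := Boussinesq.latticeConst_nonneg d
  set P : ℝ := 128 * (1 + d) * A * K with hP_def
  have hP : 0 ≤ P := by positivity
  -- `κ` cancels the factor in the bound on `ρ N`; `P + 1` makes `P / (P + 1) ≤ 1` without requiring
  -- `P ≠ 0`.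
  refine ⟨1 / (κ * (P + 1)), by positivity, ?_⟩
  intro r hr g hg e he β₀ hβ₀ u₀ η₀ hu₀ hη₀ hfin
  obtain ⟨ρ, hρ, hregion, hgρ, hρN⟩ := Boussinesq.exists_region_eq
    (C := 1 / (κ * (P + 1))) (by positivity) hr hg hβ₀ hfin
  rw [hregion]
  set N : ℝ := (Boussinesq.gevreyNorm r β₀ u₀ η₀).toReal with hN_def
  have hN : 0 ≤ N := ENNReal.toReal_nonneg
  have hNorm : Boussinesq.gevreyNorm r β₀ u₀ η₀ = ENNReal.ofReal N :=
    (ENNReal.ofReal_toReal hfin.ne).symm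
  have hη : Boussinesq.wienerNorm β₀ (Boussinesq.coeff η₀) ≤ ENNReal.ofReal (K * N) := by
    rw [ENNReal.ofReal_mul hK, ← hNorm]
    refine (Boussinesq.wienerNorm_coeff_le hr hη₀).trans ?_
    gcongr
    exact Boussinesq.gevreySq_le_gevreyNorm_scalar r β₀ u₀ η₀
  have hu : Boussinesq.vecNorm β₀ (fun i => Boussinesq.coeff (u₀ i)) ≤
      ENNReal.ofReal (A * (K * N)) := by
    have h1 : ∀ i, Boussinesq.wienerNorm β₀ (Boussinesq.coeff (u₀ i)) ≤
        ENNReal.ofReal (K * N) := by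
      intro i
      rw [ENNReal.ofReal_mul hK, ← hNorm]
      refine (Boussinesq.wienerNorm_coeff_le hr (hu₀.1 i)).trans ?_
      gcongr
      exact Boussinesq.gevreySq_le_gevreyNorm_velocity r β₀ u₀ η₀ i
    have hdA : (d : ℝ) ≤ A := by
      have : (0 : ℝ) ≤ d := Nat.cast_nonneg d
      nlinarith
    calc _ ≤ ∑ _i : Fin d, ENNReal.ofReal (K * N) := Finset.sum_le_sum fun i _ => h1 i
      _ = ENNReal.ofReal (d * (K * N)) := by
          rw [Finset.sum_const, Finset.card_univ, Fintype.card_fin, nsmul_eq_mul,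
            ENNReal.ofReal_mul (Nat.cast_nonneg d), ENNReal.ofReal_natCast]
      _ ≤ _ := by gcongr
  -- Here `c = β₀ / ρ`, so that the radius of convergence `β₀ / c` is exactly `ρ`.
  have h1 : 8 * (g * ((1 + d) * d)) * β₀ ≤ A * (β₀ / ρ) := by
    rw [mul_div_assoc', le_div_iff₀ hρ]
    calc 8 * (g * ((1 + d) * d)) * β₀ * ρ = 8 * ((1 + d) * d) * β₀ * (g * ρ) := by ring
      _ ≤ 8 * ((1 + d) * d) * β₀ * 2 := by gcongr
      _ = A * β₀ := by rw [hA_def]; ring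
  have h2 : 128 * (1 + d) * A * (K * N) ≤ β₀ / ρ := by
    rw [le_div_iff₀ hρ]
    calc 128 * (1 + d) * A * (K * N) * ρ = P * (ρ * N) := by rw [hP_def]; ring
      _ ≤ P * (κ * (1 / (κ * (P + 1))) * β₀) := by gcongr
      _ = P / (P + 1) * β₀ := by field_simp
      _ ≤ 1 * β₀ := by
          gcongr
          rw [div_le_one (by positivity)]
          linarith
      _ = β₀ := one_mul _
  have hρ_eq : β₀ / (β₀ / ρ) = ρ := by field_simp
  have H : ∀ s, 0 < s → s < ρ → ∃ β, 0 < β ∧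
      Boussinesq.SeriesBound β s (Boussinesq.scalCoeff g e
        (fun i => Boussinesq.coeff (u₀ i)) (Boussinesq.coeff η₀)) ∧
      ∀ i, Boussinesq.SeriesBound β s fun n => Boussinesq.velCoeff g e
        (fun i => Boussinesq.coeff (u₀ i)) (Boussinesq.coeff η₀) n i := fun s hs hsρ =>
    Boussinesq.exists_tsum_taylorCoeff_lt_top hg.le he hA (mul_nonneg hK hN)
      (div_pos hβ₀ hρ) hu hη h1 h2 hs.le (by rwa [hρ_eq])
  have hsol := Boussinesq.isSolution_timeSeries (g := g) (e := e)
    (R := {ζ : ℂ | 0 < ‖ζ‖ ∧ ‖ζ‖ < ρ}) hρ (fun ζ hζ => hζ.2) hu₀ hη₀ H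
  refine ⟨_, _, hsol, fun ζ hζ => ?_, fun v θ hv ζ hζ => hv.unique hρ hsol hζ⟩
  have hr0 : 0 < r := lt_trans (by positivity) hr
  obtain ⟨s, hs1, hs2⟩ := exists_between hζ.2
  have hs : 0 < s := (norm_nonneg ζ).trans_lt hs1
  obtain ⟨β, hβ, hT, hU⟩ := H s hs hs2
  exact ⟨fun i => (hU i).gevreyHolomorphicAt hβ hs hr0 hs1, hT.gevreyHolomorphicAt hβ hs hr0 hs1⟩
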